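/- Let $S^n$ be the space of real symmetric $n\times n$ matrices and let $F\colon(\mathbb R^n\setminus\{0\})\times S^n\to\mathbb R$ be continuous, with lower and upper semicontinuous envelopes $F_*$ and $F^*$ (defined on $\mathbb R^n\times S^n$, with values in $[-\infty,+\infty]$). Assume that $F_*(0,0)=0$, that $F$ is degenerate elliptic ($F(\xi,X)\ge F(\xi,Y)$ for all $\xi\neq0$ and all $X,Y\in S^n$ with $X\le Y$), and that $X\mapsto F(\xi,X)$ is convex on $S^n$ for every $\xi\ne0$. Put $G(\xi,X):=-F(\xi,\xi\otimes\xi-X)$. *Viscosity supersolutions.* Let $\Omega\subset\mathbb R^n$ be open, $H\colon(\mathbb R^n\setminus\{0\})\times S^n\to\mathbb R$ and $g\colon\mathbb R\to[-\infty,+\infty]$. A smooth function $\varphi$ on $\Omega$ touches $u\colon\Omega\to\mathbb R$ from below at $x\in\Omega$ if $\varphi(x)=u(x)$ and $\varphi\le u$ in $\Omega$. A lower semicontinuous function $u\colon\Omega\to\mathbb R$ is a viscosity supersolution of $H(\nabla u,D^2u)=g(u)$ in $\Omega$ - in the sense of Crandall–Ishii–Lions, if $H^*(\nabla\varphi(x),D^2\varphi(x))\ge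 g(\varphi(x))$ whenever $x\in\Omega$ and $\varphi$ touches $u$ from below at $x$; - in the sense of Birindelli–Demengel, if for every $x\in\Omega$: when $u$ is equal to a constant $c$ on some open ball $B_r(x)\subset\Omega$, then $0\ge g(c)$; and $H(\nabla\varphi(x),D^2\varphi(x))\ge g(\varphi(x))$ for every $\varphi$ that touches $u$ from below at $x$ with $\nabla\varphi(x)\ne0$. Fix $\alpha>-1$ and, for $\Omega\subset\mathbb R^n$ open and bounded, let $$\overline\lambda(\Omega):=\sup\big\{\lambda\in\mathbb R:\ \text{there is a viscosity supersolution } u>0 \text{ of } F(\nabla u,D^2u)=\lambda|u|^\alpha u \text{ in }\Omega\big\}\in[-\infty,+\infty].$$ Let $k\ge0$, let $\Omega_0,\dots,\Omega_k\subset\mathbb R^n$ be bounded open sets, let $t=(t_0,\dots,t_k)$ with $t_i\in(0,1]$ and $\sum_{i=0}^kt_i=1$, and put $\Omega_t:=t_0\Omega_0+\dots+t_k\Omega_k=\{\sum_{i=0}^kt_ix_i:\ x_i\in\Omega_i\}$. For every $i$ let $v_i\colon\Omega_i\to\mathbb R$ be a continuous function, bounded from below, which is a viscosity supersolution of $$G(\nabla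 v_i,D^2v_i)=-\overline\lambda(\Omega_i)\ \text{ in }\Omega_i,\qquad\text{with } v_i(x)\to+\infty\ \text{ as } x\to\partial\Omega_i .$$ Let $w$ be the weighted infimal convolution $$w(x):=\inf\Big\{\sum_{i=0}^kt_iv_i(x_i):\ x_0,\dots,x_k\in\mathbb R^n,\ \sum_{i=0}^kt_ix_i=x\Big\},\qquad v_i:=+\infty\ \text{ outside }\Omega_i .$$ Then $w$ is finite in $\Omega_t$ and is a viscosity supersolution of $$G(\nabla w,D^2w)=-\sum_{i=0}^kt_i\,\overline\lambda(\Omega_i)\ \text{ in }\Omega_t,\qquad\text{and } w(x)\to+\infty\ \text{ as } x\to\partial\Omega_t .$$ Here the sense of "viscosity supersolution" (Crandall–Ishii–Lions or Birindelli–Demengel) may be chosen arbitrarily, and independently, in the definition of $\overline\lambda$ (one choice for all sets), in the hypothesis on the $v_i$ (one choice for all $i$) and in the conclusion on $w$. -/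

import Mathlib

open Filter Topology
open scoped ContDiff

noncomputable section

/-- The domain `(ℝⁿ \ {0}) × Sⁿ` of the operators, `Sⁿ` being the symmetric real matrices.
An operator is given by a total function `F`; only its values on this set are ever used. -/
def operatorDomain (n : ℕ) :
    Set (EuclideanSpace ℝ (Fin n) × Matrix (Fin n) (Fin n) ℝ) :=
  {p | p.1 ≠ 0 ∧ p.2.IsSymm}

/-- The lower semicontinuous envelope `F_*`, defined also at `ξ = 0`, with extended real values. -/
def lowerEnvelope {n : ℕ} (F : EuclideanSpace ℝ (Fin n) → Matrix (Fin n) (Fin n) ℝ → ℝ)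
    (ξ : EuclideanSpace ℝ (Fin n)) (X : Matrix (Fin n) (Fin n) ℝ) : EReal :=
  liminf (fun p : EuclideanSpace ℝ (Fin n) × Matrix (Fin n) (Fin n) ℝ => (F p.1 p.2 : EReal))
    (𝓝[operatorDomain n] (ξ, X))

/-- The upper semicontinuous envelope `F^*`, defined also at `ξ = 0`, with extended real values. -/
def upperEnvelope {n : ℕ} (F : EuclideanSpace ℝ (Fin n) → Matrix (Fin n) (Fin n) ℝ → ℝ)
    (ξ : EuclideanSpace ℝ (Fin n)) (X : Matrix (Fin n) (Fin n) ℝ) : EReal :=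
  limsup (fun p : EuclideanSpace ℝ (Fin n) × Matrix (Fin n) (Fin n) ℝ => (F p.1 p.2 : EReal))
    (𝓝[operatorDomain n] (ξ, X))

/-- Degenerate ellipticity: `F(ξ, X) ≥ F(ξ, Y)` whenever `ξ ≠ 0` and `X ≤ Y` in `Sⁿ`. -/
def DegenerateElliptic {n : ℕ}
    (F : EuclideanSpace ℝ (Fin n) → Matrix (Fin n) (Fin n) ℝ → ℝ) : Prop :=
  ∀ ξ : EuclideanSpace ℝ (Fin n), ξ ≠ 0 → ∀ X Y : Matrix (Fin n) (Fin n) ℝ,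
    X.IsSymm → Y.IsSymm → (Y - X).PosSemidef → F ξ Y ≤ F ξ X

/-- Convexity of `X ↦ F(ξ, X)` on `Sⁿ`, for every `ξ ≠ 0`. -/
def ConvexInHessian {n : ℕ}
    (F : EuclideanSpace ℝ (Fin n) → Matrix (Fin n) (Fin n) ℝ → ℝ) : Prop :=
  ∀ ξ : EuclideanSpace ℝ (Fin n), ξ ≠ 0 →
    ConvexOn ℝ {X : Matrix (Fin n) (Fin n) ℝ | X.IsSymm} (F ξ)

/-- The operator `G(ξ, X) = -F(ξ, ξ ⊗ ξ - X)`. -/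
def modifiedOperator {n : ℕ} (F : EuclideanSpace ℝ (Fin n) → Matrix (Fin n) (Fin n) ℝ → ℝ)
    (ξ : EuclideanSpace ℝ (Fin n)) (X : Matrix (Fin n) (Fin n) ℝ) : ℝ :=
  -F ξ (Matrix.vecMulVec ξ.ofLp ξ.ofLp - X)

/-- The Hessian matrix `D²φ(x)`. -/
def hessianMatrix {n : ℕ} (φ : EuclideanSpace ℝ (Fin n) → ℝ) (x : EuclideanSpace ℝ (Fin n)) :
    Matrix (Fin n) (Fin n) ℝ :=
  Matrix.of fun i j =>
    fderiv ℝ (fderiv ℝ φ) x (EuclideanSpace.single i 1) (EuclideanSpace.single j 1)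

/-- `φ` touches `u` from below at `x`, as functions on `Ω`. -/
def TouchesFromBelow {n : ℕ} (Ω : Set (EuclideanSpace ℝ (Fin n)))
    (φ u : EuclideanSpace ℝ (Fin n) → ℝ) (x : EuclideanSpace ℝ (Fin n)) : Prop :=
  φ x = u x ∧ ∀ y ∈ Ω, φ y ≤ u y

/-- Viscosity supersolutions of `F(∇u, D²u) = g(u)` in `Ω`, according to Crandall, Ishii and
Lions: all test functions are used, together with the envelope `F^*`. -/
def IsSupersolutionCIL {n : ℕ} (F : EuclideanSpace ℝ (Fin n) → Matrix (Fin n) (Fin n) ℝ → ℝ)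
    (g : ℝ → EReal) (Ω : Set (EuclideanSpace ℝ (Fin n)))
    (u : EuclideanSpace ℝ (Fin n) → ℝ) : Prop :=
  LowerSemicontinuousOn u Ω ∧
    ∀ x ∈ Ω, ∀ φ : EuclideanSpace ℝ (Fin n) → ℝ, ContDiffOn ℝ ∞ φ Ω →
      TouchesFromBelow Ω φ u x →
        g (φ x) ≤ upperEnvelope F (gradient φ x) (hessianMatrix φ x)

/-- Viscosity supersolutions of `F(∇u, D²u) = g(u)` in `Ω`, according to Birindelli and
Demengel: where `u` is locally equal to a constant `c` one requires `0 ≥ g(c)`; otherwise only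
test functions with non-vanishing gradient are used. (Where `u` is locally constant there are no
test functions with non-vanishing gradient, so the second requirement is void there.) -/
def IsSupersolutionBD {n : ℕ} (F : EuclideanSpace ℝ (Fin n) → Matrix (Fin n) (Fin n) ℝ → ℝ)
    (g : ℝ → EReal) (Ω : Set (EuclideanSpace ℝ (Fin n)))
    (u : EuclideanSpace ℝ (Fin n) → ℝ) : Prop :=
  LowerSemicontinuousOn u Ω ∧
    ∀ x ∈ Ω,
      (∀ c r : ℝ, 0 < r → Metric.ball x r ⊆ Ω → (∀ y ∈ Metric.ball x r, u y = c) → g c ≤ 0) ∧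
      (∀ φ : EuclideanSpace ℝ (Fin n) → ℝ, ContDiffOn ℝ ∞ φ Ω → TouchesFromBelow Ω φ u x →
        gradient φ x ≠ 0 → g (φ x) ≤ (F (gradient φ x) (hessianMatrix φ x) : EReal))

/-- The two notions of viscosity supersolution. -/
inductive ViscosityNotion where
  | crandallIshiiLions
  | birindelliDemengel

/-- Viscosity supersolutions of `F(∇u, D²u) = g(u)` in `Ω`, in either of the two senses. -/
def IsViscositySupersolution {n : ℕ} (N : ViscosityNotion)
    (F : EuclideanSpace ℝ (Fin n) → Matrix (Fin n) (Fin n) ℝ → ℝ)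
    (g : ℝ → EReal) (Ω : Set (EuclideanSpace ℝ (Fin n)))
    (u : EuclideanSpace ℝ (Fin n) → ℝ) : Prop :=
  match N with
  | .crandallIshiiLions => IsSupersolutionCIL F g Ω u
  | .birindelliDemengel => IsSupersolutionBD F g Ω u

/-- The principal eigenvalue: the supremum in `[-∞, +∞]` of the real `μ` for which
`F(∇u, D²u) = μ |u|^α u` has a viscosity supersolution `u > 0` in `Ω`. -/
def principalEigenvalue {n : ℕ} (N : ViscosityNotion)
    (F : EuclideanSpace ℝ (Fin n) → Matrix (Fin n) (Fin n) ℝ → ℝ) (α : ℝ)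
    (Ω : Set (EuclideanSpace ℝ (Fin n))) : EReal :=
  sSup ((fun μ : ℝ => (μ : EReal)) '' {μ : ℝ | ∃ u : EuclideanSpace ℝ (Fin n) → ℝ,
    (∀ x ∈ Ω, 0 < u x) ∧
      IsViscositySupersolution N F (fun s : ℝ => ((μ * (|s| ^ α * s) : ℝ) : EReal)) Ω u})

/-- `v → +∞` at the boundary of `Ω`. -/
def BlowsUpAtBoundary {n : ℕ} (Ω : Set (EuclideanSpace ℝ (Fin n)))
    (v : EuclideanSpace ℝ (Fin n) → ℝ) : Prop :=
  ∀ z ∈ frontier Ω, Tendsto v (𝓝[Ω] z) atTop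

/-- The Minkowski combination `t₀ Ω₀ + ⋯ + t_k Ω_k`. -/
def minkowskiCombination {n k : ℕ} (t : Fin (k + 1) → ℝ)
    (Ω : Fin (k + 1) → Set (EuclideanSpace ℝ (Fin n))) : Set (EuclideanSpace ℝ (Fin n)) :=
  {x | ∃ y : Fin (k + 1) → EuclideanSpace ℝ (Fin n), (∀ i, y i ∈ Ω i) ∧ ∑ i, t i • y i = x}

open Classical in
/-- The extension of `v : Ω → ℝ` by `+∞` outside `Ω`. -/
def extendByTop {n : ℕ} (Ω : Set (EuclideanSpace ℝ (Fin n)))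
    (v : EuclideanSpace ℝ (Fin n) → ℝ) (x : EuclideanSpace ℝ (Fin n)) : EReal :=
  if x ∈ Ω then (v x : EReal) else ⊤

/-- The weighted infimal convolution of `v₀, …, v_k` (extended by `+∞` outside `Ω₀, …, Ω_k`). -/
def infimalConvolution {n k : ℕ} (t : Fin (k + 1) → ℝ)
    (Ω : Fin (k + 1) → Set (EuclideanSpace ℝ (Fin n)))
    (v : Fin (k + 1) → EuclideanSpace ℝ (Fin n) → ℝ) (x : EuclideanSpace ℝ (Fin n)) : EReal :=
  ⨅ (y : Fin (k + 1) → EuclideanSpace ℝ (Fin n)) (_ : ∑ i, t i • y i = x),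
    ∑ i, (t i : EReal) * extendByTop (Ω i) (v i) (y i)

end

open Filter Topology
open scoped ContDiff

/-! ### Convex and semiconcave functions, convex minorants -/

section ConvexAnalysis

variable {E : Type*} [NormedAddCommGroup E] [InnerProductSpace ℝ E]

/-! Write `λ_i` for the eigenvalue of `Ω_i`. The sublevel sets of the `v_i` are compact, so the
infimum defining `w(x)` is attained at some `x = ∑ t_i x_i`. If `φ` touches `w` from below at `x`,
then `φ(∑ t_i y_i) ≤ ∑ t_i v_i(y_i)` for all `y_i ∈ Ω_i`, with equality at `y_i = x_i`. Formally
every `v_i` then has the gradient `ξ = ∇φ(x)` at `x_i`. Suppose `ξ ≠ 0`. If the `v_i` had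
second-order subjets `(ξ, X_i)` with `∑ t_i X_i ≥ D²φ(x)`, ellipticity and concavity of `G` would
give `G(ξ, D²φ) ≥ G(ξ, ∑ t_i X_i) ≥ ∑ t_i G(ξ, X_i) ≥ -∑ t_i λ_i`.

Such subjets exist up to small errors at nearby points, with bounded Hessians
(`exists_joint_subjets_of_continuousOn`), and compactness yields the inequality
(`sum_mul_le_operator_of_touching`). This is a theorem on sums. Quadratic infimal convolution
reduces it to semiconcave functions; these are replaced, after adding a quadratic, by their convex
minorants, which are of class `C^{1,1}` and still touched by the same quadratic function. A small
linear perturbation `p` moves the contact point. The perturbation is a Lipschitz function of the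
contact point, and Lipschitz maps send null sets to null sets, so some small `p` puts the contact
point where all the minorants are twice differentiable (`exists_joint_subjets`).

Test functions with `∇φ(x) = 0` matter only for the Crandall–Ishii–Lions sense. If the inequality
failed for one of them, sliding a nondegenerate paraboloid would show that `w` is constant near `x`;
then `D²φ(x) ≤ 0`, and `F_*(0,0) = 0` gives a contradiction because the right-hand side is
nonpositive (`TestInequality.le_upperEnvelope_zero`). That sign comes from `λ_i ≥ 0`, for which the
constant `1` is a competitor (`principalEigenvalue_nonneg`). -/

theorem ConvexOn.exists_subgradient [FiniteDimensional ℝ E] {e : E → ℝ}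
    (he : ConvexOn ℝ Set.univ e) (x : E) :
    ∃ L : E →L[ℝ] ℝ, ∀ y, e x + L (y - x) ≤ e y := by
  have hcont : Continuous e := continuousOn_univ.1 (he.continuousOn isOpen_univ)
  have hconv : Convex ℝ {p : E × ℝ | e p.1 < p.2} := by
    simpa using he.convex_strict_epigraph
  have hopen : IsOpen {p : E × ℝ | e p.1 < p.2} :=
    isOpen_lt (hcont.comp continuous_fst) continuous_snd
  obtain ⟨f, hf⟩ := geometric_hahn_banach_open_point hconv hopen
    (x := (x, e x)) (by simp)
  set c : ℝ := f (0, 1) with hc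
  have hsplit : ∀ (y : E) (s : ℝ), f (y, s) = f (y, 0) + s * c := by
    intro y s
    have : ((y, s) : E × ℝ) = (y, 0) + s • ((0, 1) : E × ℝ) := by simp
    rw [this, map_add, map_smul, smul_eq_mul]
  have hc_neg : c < 0 := by
    have h1 := hf (x, e x + 1) (by simp)
    rw [hsplit x (e x + 1), hsplit x (e x)] at h1
    linarith
  refine ⟨(-c)⁻¹ • (f.comp (ContinuousLinearMap.inl ℝ E ℝ)), fun y => ?_⟩
  -- The point `(y, e y)` is not in the strict epigraph; it is approached from above.
  have key : f (y, 0) + e y * c ≤ f (x, 0) + e x * c := by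
    refine le_of_forall_pos_le_add fun ε hε => ?_
    have h1 := hf (y, e y + ε / (-c)) (by simpa using div_pos hε (neg_pos.2 hc_neg))
    rw [hsplit y, hsplit x] at h1
    have : (e y + ε / -c) * c = e y * c - ε := by
      field_simp [hc_neg.ne]
      ring
    linarith
  have hlin : f (y - x, 0) = f (y, 0) - f (x, 0) := by
    rw [← map_sub]; simp
  have hval : ((-c)⁻¹ • (f.comp (ContinuousLinearMap.inl ℝ E ℝ))) (y - x)
      = (f (y, 0) - f (x, 0)) / (-c) := by
    simp only [smul_apply, ContinuousLinearMap.comp_apply,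
      ContinuousLinearMap.inl_apply, smul_eq_mul, hlin]
    ring
  rw [hval]
  have : (f (y, 0) - f (x, 0)) / (-c) ≤ e y - e x := by
    rw [div_le_iff₀ (neg_pos.2 hc_neg)]
    nlinarith
  linarith

/-- The midpoint form of semiconcavity. -/
def MidpointSemiconcave (C : ℝ) (e : E → ℝ) : Prop :=
  ∀ x h, e (x + h) + e (x - h) ≤ 2 * e x + C * ‖h‖ ^ 2

theorem MidpointSemiconcave.le_of_subgradient {C : ℝ} {e : E → ℝ} (hs : MidpointSemiconcave C e)
    {x : E} {L : E →L[ℝ] ℝ} (hL : ∀ y, e x + L (y - x) ≤ e y) (y : E) :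
    e y ≤ e x + L (y - x) + C * ‖y - x‖ ^ 2 := by
  have h1 := hs x (y - x)
  have h2 := hL (x - (y - x))
  have h3 : x - (y - x) - x = -(y - x) := by abel
  rw [h3, map_neg] at h2
  rw [add_sub_cancel] at h1
  linarith

theorem MidpointSemiconcave.hasFDerivAt_of_subgradient {C : ℝ} {e : E → ℝ}
    (hs : MidpointSemiconcave C e)
    {x : E} {L : E →L[ℝ] ℝ} (hL : ∀ y, e x + L (y - x) ≤ e y) : HasFDerivAt e L x := by
  rw [hasFDerivAt_iff_isLittleO]
  have h1 : (fun y => e y - e x - L (y - x)) =O[𝓝 x] fun y => ‖y - x‖ ^ 2 := by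
    refine Asymptotics.IsBigO.of_bound C (Eventually.of_forall fun y => ?_)
    have h1 := hs.le_of_subgradient hL y
    have h2 := hL y
    rw [Real.norm_of_nonneg (by linarith), Real.norm_of_nonneg (by positivity)]
    linarith
  refine h1.trans_isLittleO ?_
  rw [Asymptotics.isLittleO_iff]
  intro c hc
  filter_upwards [Metric.ball_mem_nhds x hc] with y hy
  rw [mem_ball_iff_norm] at hy
  rw [Real.norm_of_nonneg (by positivity)]
  nlinarith [norm_nonneg (y - x)]

theorem ConvexOn.hasFDerivAt_of_semiconcave [FiniteDimensional ℝ E] {C : ℝ} {e : E → ℝ}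
    (he : ConvexOn ℝ Set.univ e) (hs : MidpointSemiconcave C e) (x : E) :
    HasFDerivAt e (fderiv ℝ e x) x := by
  obtain ⟨L, hL⟩ := he.exists_subgradient x
  exact (hs.hasFDerivAt_of_subgradient hL).differentiableAt.hasFDerivAt

theorem ConvexOn.fderiv_subgradient [FiniteDimensional ℝ E] {C : ℝ} {e : E → ℝ}
    (he : ConvexOn ℝ Set.univ e) (hs : MidpointSemiconcave C e) (x y : E) :
    e x + fderiv ℝ e x (y - x) ≤ e y := by
  obtain ⟨L, hL⟩ := he.exists_subgradient x
  rw [(hs.hasFDerivAt_of_subgradient hL).fderiv]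
  exact hL y

/-- Affine support from below and a paraboloid of fixed opening from above leave the gradient only
linear room to vary. -/
theorem ConvexOn.lipschitzWith_fderiv_of_semiconcave [FiniteDimensional ℝ E] {C : ℝ} {e : E → ℝ}
    (hC : 0 ≤ C) (he : ConvexOn ℝ Set.univ e) (hs : MidpointSemiconcave C e) :
    LipschitzWith (Real.toNNReal (2 * C)) (fderiv ℝ e) := by
  refine LipschitzWith.of_dist_le_mul fun x y => ?_
  rw [dist_eq_norm, dist_eq_norm, Real.coe_toNNReal _ (by positivity)]
  rcases eq_or_ne x y with rfl | hxy
  · simp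
  have hd : 0 < ‖x - y‖ := norm_pos_iff.2 (sub_ne_zero.2 hxy)
  -- Compare at `y + w` the tangent plane at `x` (below) with the paraboloid at `y` (above), and
  -- bound `e y` by the paraboloid at `x`. Taking `‖w‖ = ‖x - y‖` then gives the constant `2 * C`.
  have key : ∀ w : E, (fderiv ℝ e x - fderiv ℝ e y) w ≤ C * ‖x - y‖ ^ 2 + C * ‖w‖ ^ 2 := by
    intro w
    have h1 := he.fderiv_subgradient hs x (y + w)
    have h2 := hs.le_of_subgradient (he.fderiv_subgradient hs y) (y + w)
    have h3 := hs.le_of_subgradient (he.fderiv_subgradient hs x) y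
    have h4 : fderiv ℝ e x (y + w - x) = fderiv ℝ e x (y - x) + fderiv ℝ e x w := by
      rw [← map_add]; congr 1; abel
    rw [add_sub_cancel_left] at h2
    rw [h4] at h1
    rw [norm_sub_rev y x] at h3
    have h5 := he.fderiv_subgradient hs x y
    have h6 := hs.le_of_subgradient (he.fderiv_subgradient hs x) y
    rw [sub_apply]
    rw [norm_sub_rev y x] at h6
    linarith
  refine ContinuousLinearMap.opNorm_le_bound _ (by positivity) fun w => ?_
  have hone : ∀ w : E, (fderiv ℝ e x - fderiv ℝ e y) w ≤ 2 * C * ‖x - y‖ * ‖w‖ := by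
    intro w
    rcases eq_or_ne w 0 with rfl | hw
    · simp
    have hw' : 0 < ‖w‖ := norm_pos_iff.2 hw
    have h1 := key ((‖x - y‖ / ‖w‖) • w)
    rw [map_smul, norm_smul, smul_eq_mul, Real.norm_of_nonneg (by positivity),
      div_mul_cancel₀ _ hw'.ne'] at h1
    rw [div_mul_eq_mul_div, div_le_iff₀ hw'] at h1
    have : ‖x - y‖ * (fderiv ℝ e x - fderiv ℝ e y) w ≤ ‖x - y‖ * (2 * C * ‖x - y‖ * ‖w‖) := by
      linarith
    exact le_of_mul_le_mul_left this hd
  rw [Real.norm_eq_abs, abs_le]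
  refine ⟨?_, hone w⟩
  have := hone (-w)
  rw [map_neg, norm_neg] at this
  linarith

/-- The largest convex minorant of a function. -/
noncomputable def convexMinorant (g : E → ℝ) (x : E) : ℝ :=
  sSup {a | ∃ k : E → ℝ, ConvexOn ℝ Set.univ k ∧ (∀ y, k y ≤ g y) ∧ k x = a}

theorem le_convexMinorant {g k : E → ℝ} (hk : ConvexOn ℝ Set.univ k) (hkg : ∀ y, k y ≤ g y)
    (x : E) : k x ≤ convexMinorant g x :=
  le_csSup ⟨g x, by rintro _ ⟨k, -, h, rfl⟩; exact h x⟩ ⟨k, hk, hkg, rfl⟩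

theorem convexMinorant_le {g : E → ℝ} {m : ℝ} (hm : ∀ y, m ≤ g y) (x : E) :
    convexMinorant g x ≤ g x := by
  refine csSup_le ⟨m, fun _ => m, convexOn_const _ convex_univ, hm, rfl⟩ ?_
  rintro _ ⟨k, -, h, rfl⟩
  exact h x

theorem convexOn_convexMinorant {g : E → ℝ} {m : ℝ} (hm : ∀ y, m ≤ g y) :
    ConvexOn ℝ Set.univ (convexMinorant g) := by
  refine ⟨convex_univ, fun x _ y _ a b ha hb hab => ?_⟩
  refine csSup_le ⟨m, fun _ => m, convexOn_const _ convex_univ, hm, rfl⟩ ?_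
  rintro _ ⟨k, hk, h, rfl⟩
  refine (hk.2 (Set.mem_univ x) (Set.mem_univ y) ha hb hab).trans ?_
  simp only [smul_eq_mul]
  have h1 := le_convexMinorant hk h x
  have h2 := le_convexMinorant hk h y
  gcongr

/-- The average of the minorant translated by `h` and by `-h`, lowered by `C‖h‖²/2`, is convex and
lies below `g`, hence below the minorant. -/
theorem midpointSemiconcave_convexMinorant {g : E → ℝ} {m C : ℝ} (hm : ∀ y, m ≤ g y)
    (hg : MidpointSemiconcave C g) : MidpointSemiconcave C (convexMinorant g) := by
  intro x h
  have hconv := convexOn_convexMinorant hm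
  have hk : ConvexOn ℝ Set.univ fun y =>
      (1 / 2 : ℝ) • (convexMinorant g (h + y)) + (1 / 2 : ℝ) • (convexMinorant g (-h + y))
        + (-(C * ‖h‖ ^ 2 / 2)) := by
    refine ((ConvexOn.smul (by norm_num) ?_).add (ConvexOn.smul (by norm_num) ?_)).add
      (convexOn_const _ convex_univ)
    · simpa using! hconv.translate_right h
    · simpa using! hconv.translate_right (-h)
  have := le_convexMinorant (g := g) hk (fun y => ?_) x
  · simp only [smul_eq_mul] at this
    rw [add_comm x h, sub_eq_neg_add x h]
    linarith
  · have h1 := hg y h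
    have h2 := convexMinorant_le hm (h + y)
    have h3 := convexMinorant_le hm (-h + y)
    rw [add_comm y h, sub_eq_neg_add y h] at h1
    simp only [smul_eq_mul]
    linarith

/-- Only differentiability of the gradient at the single point `x` is available. It bounds the
gradient of the Taylor remainder by `δ‖y - x‖` on the ball of radius `‖y - x‖`, and the mean value
inequality concludes. -/
theorem eventually_abs_sub_taylor_le {f : E → ℝ} {x : E} {H : E →L[ℝ] E →L[ℝ] ℝ}
    (hf : ∀ᶠ y in 𝓝 x, DifferentiableAt ℝ f y) (hH : HasFDerivAt (fderiv ℝ f) H x)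
    {δ : ℝ} (hδ : 0 < δ) :
    ∀ᶠ y in 𝓝 x, |f y - (f x + fderiv ℝ f x (y - x) + 1 / 2 * H (y - x) (y - x))|
      ≤ δ * ‖y - x‖ ^ 2 := by
  have hsymm := second_derivative_symmetric_of_eventually
    (hf.mono fun y hy => hy.hasFDerivAt) hH
  have h1 := (hasFDerivAt_iff_isLittleO.1 hH).def hδ
  obtain ⟨r, hr, hball⟩ := Metric.eventually_nhds_iff_ball.1 (h1.and hf)
  filter_upwards [Metric.ball_mem_nhds x hr] with y hy
  rw [mem_ball_iff_norm] at hy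
  set ρ : E → ℝ := fun z => f z - (f x + fderiv ℝ f x (z - x) + 1 / 2 * H (z - x) (z - x)) with hρ
  have hder : ∀ z ∈ Metric.closedBall x ‖y - x‖,
      HasFDerivWithinAt ρ (fderiv ℝ f z - fderiv ℝ f x - H (z - x))
        (Metric.closedBall x ‖y - x‖) z := by
    intro z hz
    have hz' : z ∈ Metric.ball x r := Metric.closedBall_subset_ball hy hz
    have hsub : HasFDerivAt (fun z : E => z - x) (ContinuousLinearMap.id ℝ E) z :=
      (hasFDerivAt_id z).sub_const x
    have hlin : HasFDerivAt (fun z : E => fderiv ℝ f x (z - x)) (fderiv ℝ f x) z := by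
      exact ((fderiv ℝ f x).hasFDerivAt.comp z hsub).congr_fderiv (ContinuousLinearMap.comp_id _)
    have hHz : HasFDerivAt (fun z : E => H (z - x)) H z := by
      exact (H.hasFDerivAt.comp z hsub).congr_fderiv (ContinuousLinearMap.comp_id _)
    have hquad := hHz.clm_apply hsub
    have hall := (hball z hz').2.hasFDerivAt.sub
      (((hasFDerivAt_const (f x) z).add hlin).add (hquad.const_mul (1 / 2)))
    refine (hall.congr_fderiv ?_).hasFDerivWithinAt
    ext w
    have := hsymm w (z - x)
    rw [map_sub, map_sub, sub_apply] at this
    simp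
    linarith
  have hbound : ∀ z ∈ Metric.closedBall x ‖y - x‖,
      ‖fderiv ℝ f z - fderiv ℝ f x - H (z - x)‖ ≤ δ * ‖y - x‖ := by
    intro z hz
    have hz' : z ∈ Metric.ball x r := Metric.closedBall_subset_ball hy hz
    refine (hball z hz').1.trans ?_
    rw [mem_closedBall_iff_norm] at hz
    gcongr
  have hmv := (convex_closedBall x ‖y - x‖).norm_image_sub_le_of_norm_hasFDerivWithin_le
    hder hbound (Metric.mem_closedBall_self (norm_nonneg _))
    (mem_closedBall_iff_norm.2 le_rfl)
  have hx0 : ρ x = 0 := by simp [hρ]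
  rw [hx0, sub_zero, Real.norm_eq_abs] at hmv
  calc _ = |ρ y| := rfl
    _ ≤ _ := by rw [pow_two, ← mul_assoc]; exact hmv

end ConvexAnalysis

/-! ### Convexity tools and weighted quadratic forms -/

section JointSubjets

theorem convexOn_univ_of_support {E : Type*} [NormedAddCommGroup E] [NormedSpace ℝ E] {k : E → ℝ}
    (h : ∀ x, ∃ L : E →L[ℝ] ℝ, ∀ d, k x + L d ≤ k (x + d)) : ConvexOn ℝ Set.univ k := by
  refine ⟨convex_univ, fun x _ y _ a b ha hb hab => ?_⟩
  obtain ⟨L, hL⟩ := h (a • x + b • y)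
  have h1 := hL (b • (x - y))
  have h2 := hL (a • (y - x))
  have e1 : a • x + b • y + b • (x - y) = x := by
    rw [add_assoc, ← smul_add, add_sub_cancel, ← add_smul, hab, one_smul]
  have e2 : a • x + b • y + a • (y - x) = y := by
    rw [add_right_comm, ← smul_add, add_sub_cancel, ← add_smul, hab, one_smul]
  rw [e1] at h1
  rw [e2] at h2
  rw [map_smul, smul_eq_mul, map_sub] at h1 h2
  simp only [smul_eq_mul]
  have h3 := mul_le_mul_of_nonneg_left h1 ha
  have h4 := mul_le_mul_of_nonneg_left h2 hb
  have h5 : a * k (a • x + b • y) + b * k (a • x + b • y) = k (a • x + b • y) := by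
    rw [← add_mul, hab, one_mul]
  nlinarith

/-- The image of a null set is null for the Hausdorff measure of full dimension, which charges every
ball. -/
theorem LipschitzWith.exists_small_notMem_image {V : Type*} [NormedAddCommGroup V]
    [NormedSpace ℝ V] [FiniteDimensional ℝ V] [MeasurableSpace V] [BorelSpace V]
    (μ : MeasureTheory.Measure V) [μ.IsAddHaarMeasure] {T : V → V} {K : NNReal}
    (hT : LipschitzWith K T) {N : Set V} (hN : μ N = 0) {s : ℝ} (hs : 0 < s) :
    ∃ p, ‖p‖ < s ∧ p ∉ T '' N := by
  set ν : MeasureTheory.Measure V := MeasureTheory.Measure.hausdorffMeasure (Module.finrank ℝ V)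
  have hνN : ν N = 0 :=
    MeasureTheory.Measure.absolutelyContinuous_isAddHaarMeasure ν μ hN
  have himg : ν (T '' N) = 0 := by
    refine le_antisymm ((hT.hausdorffMeasure_image_le (by positivity) N).trans ?_) bot_le
    change _ * ν N ≤ 0
    rw [hνN, mul_zero]
  have hball : ν (Metric.ball 0 s) ≠ 0 := (Metric.measure_ball_pos ν 0 hs).ne'
  by_contra! hcon
  exact hball (MeasureTheory.measure_mono_null
    (fun p hp => hcon p (mem_ball_zero_iff.1 hp)) himg)

/-- The `g i` can be replaced by their convex minorants one at a time: with the other variables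
frozen, the inequality bounds `g j` from below by a convex function of the `j`-th variable. -/
theorem sum_le_sum_convexMinorant {ι E : Type*} [Fintype ι] [NormedAddCommGroup E]
    [InnerProductSpace ℝ E] {t : ι → ℝ} (ht : ∀ i, 0 < t i) {g : ι → E → ℝ} {k : (ι → E) → ℝ}
    (hk : ∀ x, ∃ L : ι → E →L[ℝ] ℝ, ∀ d, k x + ∑ i, t i * L i (d i) ≤ k (x + d))
    (hkg : ∀ q, k q ≤ ∑ i, t i * g i (q i)) (q : ι → E) :
    k q ≤ ∑ i, t i * convexMinorant (g i) (q i) := by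
  classical
  suffices h : ∀ S : Finset ι, ∀ q, k q ≤
      ∑ i, t i * (if i ∈ S then convexMinorant (g i) (q i) else g i (q i)) by
    simpa using h Finset.univ q
  intro S
  induction S using Finset.induction_on with
  | empty => simpa using hkg
  | insert j S hj ih =>
    intro q
    set R : ℝ := ∑ i ∈ Finset.univ.erase j,
      t i * (if i ∈ S then convexMinorant (g i) (q i) else g i (q i)) with hR
    have hconv : ConvexOn ℝ Set.univ fun y => (t j)⁻¹ * (k (Function.update q j y) - R) := by
      refine convexOn_univ_of_support fun y => ?_
      obtain ⟨L, hL⟩ := hk (Function.update q j y)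
      refine ⟨L j, fun d => ?_⟩
      have h1 := hL (Pi.single j d)
      rw [Finset.sum_eq_single j (fun i _ hij => by simp [hij]) (by simp)] at h1
      have h2 : Function.update q j y + Pi.single j d = Function.update q j (y + d) := by
        ext i
        rcases eq_or_ne i j with rfl | hij
        · simp
        · simp [hij]
      rw [h2, Pi.single_eq_same] at h1
      have h3 : L j d = (t j)⁻¹ * (t j * L j d) := by field_simp [(ht j).ne']
      rw [h3, ← mul_add]
      exact mul_le_mul_of_nonneg_left (by linarith) (inv_nonneg.2 (ht j).le)
    have hle : ∀ y, (t j)⁻¹ * (k (Function.update q j y) - R) ≤ g j y := by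
      intro y
      have h1 := ih (Function.update q j y)
      rw [← Finset.add_sum_erase _ _ (Finset.mem_univ j)] at h1
      simp only [hj, if_false, Function.update_self] at h1
      rw [Finset.sum_congr rfl (g := fun i =>
        t i * (if i ∈ S then convexMinorant (g i) (q i) else g i (q i)))
        (fun i hi => by rw [Function.update_of_ne (Finset.ne_of_mem_erase hi)])] at h1
      rw [inv_mul_le_iff₀ (ht j)]
      linarith
    have h1 := le_convexMinorant hconv hle (q j)
    rw [Function.update_eq_self, inv_mul_le_iff₀ (ht j)] at h1
    rw [← Finset.add_sum_erase _ _ (Finset.mem_univ j)]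
    rw [Finset.sum_congr rfl (g := fun i =>
        t i * (if i ∈ S then convexMinorant (g i) (q i) else g i (q i)))
        (fun i hi => by simp [Finset.ne_of_mem_erase hi])]
    simp only [Finset.mem_insert_self, if_true]
    linarith

variable {ι E : Type*} [Fintype ι] [NormedAddCommGroup E] [InnerProductSpace ℝ E]

/-- The weighted quadratic form `½ B(q̄, q̄) + (c / 2) ∑ tᵢ |qᵢ|²`, where `q̄ = ∑ tᵢ qᵢ`. -/
noncomputable def weightedQuadratic (t : ι → ℝ) (B : E →L[ℝ] E →L[ℝ] ℝ) (c : ℝ) (q : ι → E) : ℝ :=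
  1 / 2 * B (∑ i, t i • q i) (∑ i, t i • q i) + c / 2 * ∑ i, t i * ‖q i‖ ^ 2

theorem weightedQuadratic_add {t : ι → ℝ} {B : E →L[ℝ] E →L[ℝ] ℝ} (hB : ∀ x y, B x y = B y x)
    (c : ℝ) (q d : ι → E) :
    weightedQuadratic t B c (q + d) = weightedQuadratic t B c q
      + ∑ i, t i * (B (∑ j, t j • q j) (d i) + c * inner ℝ (q i) (d i))
      + weightedQuadratic t B c d := by
  have h1 : ∑ i, t i • (q + d) i = ∑ i, t i • q i + ∑ i, t i • d i := by
    simp [smul_add, Finset.sum_add_distrib]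
  have h2 : ∑ i, t i * ‖(q + d) i‖ ^ 2 = ∑ i, t i * ‖q i‖ ^ 2
      + 2 * ∑ i, t i * inner ℝ (q i) (d i) + ∑ i, t i * ‖d i‖ ^ 2 := by
    rw [Finset.mul_sum, ← Finset.sum_add_distrib, ← Finset.sum_add_distrib]
    refine Finset.sum_congr rfl fun i _ => ?_
    rw [Pi.add_apply, norm_add_sq_real]
    ring
  have h3 : ∑ i, t i * (B (∑ j, t j • q j) (d i) + c * inner ℝ (q i) (d i))
      = B (∑ j, t j • q j) (∑ i, t i • d i) + c * ∑ i, t i * inner ℝ (q i) (d i) := by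
    generalize ∑ j, t j • q j = b
    rw [map_sum, Finset.mul_sum, ← Finset.sum_add_distrib]
    refine Finset.sum_congr rfl fun i _ => ?_
    rw [map_smul, smul_eq_mul]
    ring
  rw [weightedQuadratic, weightedQuadratic, weightedQuadratic, h1, h2, h3]
  simp only [map_add, add_apply]
  rw [hB (∑ i, t i • d i) (∑ i, t i • q i)]
  ring

theorem norm_sq_sum_smul_le {t : ι → ℝ} (ht : ∀ i, 0 < t i) (hsum : ∑ i, t i = 1) (q : ι → E) :
    ‖∑ i, t i • q i‖ ^ 2 ≤ ∑ i, t i * ‖q i‖ ^ 2 := by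
  have h := (convexOn_norm (E := E) convex_univ).pow (fun _ _ => norm_nonneg _) 2
  simpa using h.map_sum_le (t := Finset.univ) (w := t) (p := q) (fun i _ => (ht i).le) hsum
    (fun i _ => Set.mem_univ _)

theorem abs_bilin_le (B : E →L[ℝ] E →L[ℝ] ℝ) (x y : E) : |B x y| ≤ ‖B‖ * ‖x‖ * ‖y‖ := by
  rw [← Real.norm_eq_abs]
  exact B.le_opNorm₂ x y

theorem abs_bilin_self_le (B : E →L[ℝ] E →L[ℝ] ℝ) (x : E) : |B x x| ≤ ‖B‖ * ‖x‖ ^ 2 := by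
  rw [pow_two, ← mul_assoc]
  exact abs_bilin_le B x x

/-- By `weightedQuadratic_add`, nonnegativity for `c = ‖B‖` also says that this quadratic function
lies above its tangent planes. -/
theorem weightedQuadratic_nonneg {t : ι → ℝ} (ht : ∀ i, 0 < t i) (hsum : ∑ i, t i = 1)
    (B : E →L[ℝ] E →L[ℝ] ℝ) (q : ι → E) : 0 ≤ weightedQuadratic t B ‖B‖ q := by
  have h1 := abs_le.1 (abs_bilin_self_le B (∑ i, t i • q i))
  have h2 := mul_le_mul_of_nonneg_left (norm_sq_sum_smul_le ht hsum q) (norm_nonneg B)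
  rw [weightedQuadratic]
  linarith [h1.1]

end JointSubjets

/-! ### Joint subjets of semiconcave functions -/

section JointSubjets

variable {ι E : Type*} [Fintype ι] [NormedAddCommGroup E] [InnerProductSpace ℝ E]

theorem continuous_weightedQuadratic (t : ι → ℝ) (B : E →L[ℝ] E →L[ℝ] ℝ) (c : ℝ) :
    Continuous (weightedQuadratic t B c) := by
  unfold weightedQuadratic
  fun_prop

theorem weightedQuadratic_zero (t : ι → ℝ) (B : E →L[ℝ] E →L[ℝ] ℝ) (c : ℝ) :
    weightedQuadratic t B c 0 = 0 := by
  simp [weightedQuadratic]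

theorem weightedQuadratic_le {t : ι → ℝ} (ht : ∀ i, 0 < t i) (hsum : ∑ i, t i = 1)
    (B : E →L[ℝ] E →L[ℝ] ℝ) {c ρ : ℝ} (hc : c ≤ 0) {q : ι → E} (hq : ∀ i, ‖q i‖ ≤ ρ) :
    weightedQuadratic t B c q ≤ 1 / 2 * ‖B‖ * ρ ^ 2 := by
  have h1 := (abs_le.1 (abs_bilin_self_le B (∑ i, t i • q i))).2
  have h2 := mul_le_mul_of_nonneg_left (norm_sq_sum_smul_le ht hsum q) (norm_nonneg B)
  have h3 : ∑ i, t i * ‖q i‖ ^ 2 ≤ ρ ^ 2 := by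
    calc ∑ i, t i * ‖q i‖ ^ 2 ≤ ∑ i, t i * ρ ^ 2 := by
          refine Finset.sum_le_sum fun i _ => mul_le_mul_of_nonneg_left ?_ (ht i).le
          exact pow_le_pow_left₀ (norm_nonneg _) (hq i) 2
      _ = ρ ^ 2 := by rw [← Finset.sum_mul, hsum, one_mul]
  have h4 : 0 ≤ ∑ i, t i * ‖q i‖ ^ 2 :=
    Finset.sum_nonneg fun i _ => mul_nonneg (ht i).le (sq_nonneg _)
  have h5 := mul_le_mul_of_nonneg_left h3 (norm_nonneg B)
  have h6 := mul_nonneg (neg_nonneg.2 hc) h4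
  rw [weightedQuadratic]
  linarith

theorem sum_mul_inner_le {t : ι → ℝ} (ht : ∀ i, 0 < t i) (hsum : ∑ i, t i = 1) {p q : ι → E}
    {s ρ : ℝ} (hs : 0 ≤ s) (hp : ∀ i, ‖p i‖ ≤ s) (hq : ∀ i, ‖q i‖ ≤ ρ) :
    ∑ i, t i * inner ℝ (p i) (q i) ≤ s * ρ := by
  calc ∑ i, t i * inner ℝ (p i) (q i) ≤ ∑ i, t i * (s * ρ) := by
        refine Finset.sum_le_sum fun i _ => mul_le_mul_of_nonneg_left ?_ (ht i).le
        exact (real_inner_le_norm _ _).trans (mul_le_mul (hp i) (hq i) (norm_nonneg _) hs)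
    _ = s * ρ := by rw [← Finset.sum_mul, hsum, one_mul]

/-- Lowering the coefficient from `-2δ` to `-4δ` leaves a surplus `δ ∑ t_i ‖q_i‖²`, which absorbs a
small linear term. Minimisers therefore exist and are small. -/
theorem exists_perturbed_minimizer [FiniteDimensional ℝ E] [Nonempty ι] {t : ι → ℝ}
    (ht : ∀ i, 0 < t i)
    (hsum : ∑ i, t i = 1) {f : ι → E → ℝ} {δ : ℝ} (hδ : 0 < δ) (hcont : ∀ i, Continuous (f i))
    (B : E →L[ℝ] E →L[ℝ] ℝ)
    (h : ∀ q : ι → E, weightedQuadratic t B (-(2 * δ)) q ≤ ∑ i, t i * f i (q i))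
    (h0 : ∀ i, f i 0 ≤ 0) {ρ : ℝ} (hρ : 0 < ρ) :
    ∃ s, 0 < s ∧ s ≤ ρ ∧ ∀ p : ι → E, (∀ i, ‖p i‖ ≤ s) → ∃ q : ι → E, (∀ i, ‖q i‖ ≤ ρ) ∧
      (∑ i, t i * f i (q i) ≤
        weightedQuadratic t B (-(4 * δ)) q + ∑ i, t i * inner ℝ (p i) (q i)) ∧
      ∀ q' : ι → E, ∑ i, t i * f i (q i) - weightedQuadratic t B (-(4 * δ)) q
          - ∑ i, t i * inner ℝ (p i) (q i)
        ≤ ∑ i, t i * f i (q' i) - weightedQuadratic t B (-(4 * δ)) q'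
          - ∑ i, t i * inner ℝ (p i) (q' i) := by
  obtain ⟨i₀, hi₀⟩ := Finite.exists_min t
  set τ := t i₀ with hτ
  have hτ0 : 0 < τ := ht i₀
  have hτ1 : τ ≤ 1 := by
    rw [← hsum]
    exact Finset.single_le_sum (f := t) (fun i _ => (ht i).le) (Finset.mem_univ i₀)
  -- With `‖p i‖ ≤ δτρ`, Young's inequality gives `∑ t_i ‖q_i‖² ≤ τ²ρ²` on the sublevel set `H ≤ 0`,
  -- hence `‖q_i‖ ≤ ρ` because `t_i ≥ τ`.
  refine ⟨min ρ (δ * τ * ρ), lt_min hρ (by positivity), min_le_left _ _, fun p hp => ?_⟩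
  have hp' : ∀ i, ‖p i‖ ≤ δ * τ * ρ := fun i => (hp i).trans (min_le_right _ _)
  set H : (ι → E) → ℝ := fun q => ∑ i, t i * f i (q i) - weightedQuadratic t B (-(4 * δ)) q
          - ∑ i, t i * inner ℝ (p i) (q i) with hH
  have hHcont : Continuous H := by
    have := continuous_weightedQuadratic t B (-(4 * δ))
    fun_prop
  have hH0 : H 0 ≤ 0 := by
    simp only [hH, weightedQuadratic_zero, Pi.zero_apply, inner_zero_right, mul_zero,
      Finset.sum_const_zero, sub_zero]
    exact Finset.sum_nonpos fun i _ => mul_nonpos_of_nonneg_of_nonpos (ht i).le (h0 i)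
  have hcoer : ∀ q, H q ≤ 0 → ∀ i, ‖q i‖ ≤ ρ := by
    intro q hq i
    have h1 := h q
    have h2 : δ * ∑ i, t i * ‖q i‖ ^ 2 ≤ ∑ i, t i * inner ℝ (p i) (q i) := by
      simp only [hH, weightedQuadratic] at hq h1
      linarith
    have h3 : ∑ i, t i * inner ℝ (p i) (q i)
        ≤ ∑ i, t i * (δ / 2 * ‖q i‖ ^ 2 + δ * τ ^ 2 * ρ ^ 2 / 2) := by
      refine Finset.sum_le_sum fun i _ => mul_le_mul_of_nonneg_left ?_ (ht i).le
      have h5 : inner ℝ (p i) (q i) ≤ δ * τ * ρ * ‖q i‖ :=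
        (real_inner_le_norm _ _).trans (mul_le_mul_of_nonneg_right (hp' i) (norm_nonneg _))
      nlinarith [mul_nonneg hδ.le (sq_nonneg (‖q i‖ - τ * ρ))]
    have h4 : ∑ i, t i * (δ / 2 * ‖q i‖ ^ 2 + δ * τ ^ 2 * ρ ^ 2 / 2)
        = δ / 2 * ∑ i, t i * ‖q i‖ ^ 2 + δ * τ ^ 2 * ρ ^ 2 / 2 := by
      simp only [mul_add, Finset.sum_add_distrib, ← Finset.sum_mul, hsum, Finset.mul_sum]
      rw [one_mul]
      congr 1
      exact Finset.sum_congr rfl fun i _ => by ring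
    have h5 : t i * ‖q i‖ ^ 2 ≤ ∑ i, t i * ‖q i‖ ^ 2 :=
      Finset.single_le_sum (f := fun i => t i * ‖q i‖ ^ 2)
        (fun i _ => mul_nonneg (ht i).le (sq_nonneg _)) (Finset.mem_univ i)
    have h6 : δ * (∑ i, t i * ‖q i‖ ^ 2) ≤ δ * (τ ^ 2 * ρ ^ 2) := by linarith
    have h7 := le_of_mul_le_mul_left h6 hδ
    have h8 : τ * ‖q i‖ ^ 2 ≤ τ * (τ * ρ ^ 2) := by
      have := mul_le_mul_of_nonneg_right (hi₀ i) (sq_nonneg ‖q i‖)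
      nlinarith
    have h9 := le_of_mul_le_mul_left h8 hτ0
    have h10 : ‖q i‖ ^ 2 ≤ ρ ^ 2 := by nlinarith [sq_nonneg ρ]
    exact (pow_le_pow_iff_left₀ (norm_nonneg _) hρ.le two_ne_zero).1 h10
  obtain ⟨q, hq⟩ := hHcont.exists_forall_le' 0 (by
    filter_upwards [(tendsto_norm_cocompact_atTop (E := ι → E)).eventually_gt_atTop ρ] with q hq
    by_contra! hlt
    exact hq.not_ge ((pi_norm_le_iff_of_nonneg hρ.le).2 (hcoer q (hlt.le.trans hH0))))
  have hq0 : H q ≤ 0 := (hq 0).trans hH0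
  refine ⟨q, hcoer q hq0, ?_, hq⟩
  simp only [hH] at hq0
  linarith

/-- The real inner product as a continuous bilinear form. -/
noncomputable def innerBilin (E : Type*) [NormedAddCommGroup E] [InnerProductSpace ℝ E] :
    E →L[ℝ] E →L[ℝ] ℝ := innerSL ℝ

theorem innerBilin_apply (x y : E) : innerBilin E x y = inner ℝ x y := rfl

theorem norm_innerBilin_apply (x : E) : ‖innerBilin E x‖ = ‖x‖ := innerSL_apply_norm ℝ x

theorem norm_smul_innerBilin_le {M : ℝ} (hM : 0 ≤ M) : ‖M • innerBilin E‖ ≤ M := by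
  refine ContinuousLinearMap.opNorm_le_bound _ hM fun x => ?_
  rw [smul_apply, norm_smul, norm_innerBilin_apply, Real.norm_of_nonneg hM]

/-- Move all variables by the same vector `s • ζ` and compare the terms of order `s²`; since the
weights sum to `1`, the mean also moves by `s • ζ`. -/
theorem le_sum_of_weightedQuadratic_le {t : ι → ℝ} (ht : ∀ i, 0 < t i) (hsum : ∑ i, t i = 1)
    {e : ι → E → ℝ} {q : ι → E} {L : ι → E →L[ℝ] ℝ} {H : ι → E →L[ℝ] E →L[ℝ] ℝ}
    {B : E →L[ℝ] E →L[ℝ] ℝ} {c : ℝ}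
    (htaylor : ∀ i, ∀ η' : ℝ, 0 < η' → ∀ᶠ y in 𝓝 (q i),
      |e i y - (e i (q i) + L i (y - q i) + 1 / 2 * H i (y - q i) (y - q i))|
        ≤ η' * ‖y - q i‖ ^ 2)
    (hk : ∀ d : ι → E, ∑ i, t i * e i (q i) + ∑ i, t i * L i (d i) + weightedQuadratic t B c d
      ≤ ∑ i, t i * e i (q i + d i)) (ζ : E) :
    B ζ ζ + c * ‖ζ‖ ^ 2 ≤ ∑ i, t i * H i ζ ζ := by
  refine le_of_forall_pos_le_add fun η' hη' => ?_
  set ε : ℝ := η' / (2 * (‖ζ‖ ^ 2 + 1)) with hε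
  have hε0 : 0 < ε := by positivity
  have hlim : ∀ i, Tendsto (fun s : ℝ => q i + s • ζ) (𝓝[>] 0) (𝓝 (q i)) := by
    intro i
    have : Continuous fun s : ℝ => q i + s • ζ := by fun_prop
    simpa using (this.tendsto 0).mono_left nhdsWithin_le_nhds
  have hev : ∀ᶠ s : ℝ in 𝓝[>] 0, ∀ i, e i (q i + s • ζ) ≤
      e i (q i) + s * L i ζ + 1 / 2 * s ^ 2 * H i ζ ζ + ε * s ^ 2 * ‖ζ‖ ^ 2 := by
    refine eventually_all.2 fun i => ?_
    filter_upwards [(hlim i).eventually (htaylor i ε hε0)] with s hs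
    rw [add_sub_cancel_left] at hs
    simp only [map_smul, smul_apply, smul_eq_mul, norm_smul, Real.norm_eq_abs,
      mul_pow, sq_abs] at hs
    linarith [(abs_le.1 hs).2]
  obtain ⟨s, hs, hspos⟩ := (hev.and self_mem_nhdsWithin).exists
  have hspos : 0 < s := hspos
  have h1 := hk (fun _ => s • ζ)
  have h2 : ∑ i, t i * e i (q i + s • ζ) ≤ ∑ i, t i * e i (q i)
      + ∑ i, t i * L i (s • ζ) + 1 / 2 * s ^ 2 * ∑ i, t i * H i ζ ζ
      + ε * s ^ 2 * ‖ζ‖ ^ 2 := by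
    calc _ ≤ ∑ i, t i * (e i (q i) + s * L i ζ + 1 / 2 * s ^ 2 * H i ζ ζ
          + ε * s ^ 2 * ‖ζ‖ ^ 2) :=
        Finset.sum_le_sum fun i _ => mul_le_mul_of_nonneg_left (hs i) (ht i).le
      _ = _ := by
        simp only [mul_add, Finset.sum_add_distrib, ← Finset.sum_mul, hsum, Finset.mul_sum,
          map_smul, smul_eq_mul]
        rw [one_mul]
        congr 3
        exact funext fun i => by ring
  have h3 : weightedQuadratic t B c (fun _ : ι => s • ζ)
      = s ^ 2 * (1 / 2 * B ζ ζ + c / 2 * ‖ζ‖ ^ 2) := by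
    simp only [weightedQuadratic, ← Finset.sum_smul, ← Finset.sum_mul, hsum, map_smul,
      smul_apply, norm_smul, smul_eq_mul, Real.norm_eq_abs, mul_pow, sq_abs]
    ring
  have h4 : s ^ 2 * (1 / 2 * B ζ ζ + c / 2 * ‖ζ‖ ^ 2)
      ≤ s ^ 2 * (1 / 2 * ∑ i, t i * H i ζ ζ + ε * ‖ζ‖ ^ 2) := by
    linarith
  have h5 := le_of_mul_le_mul_left h4 (by positivity)
  have h6 : 2 * (ε * ‖ζ‖ ^ 2) ≤ η' := by
    have : ε * (2 * (‖ζ‖ ^ 2 + 1)) = η' := by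
      rw [hε]; field_simp
    nlinarith
  linarith

/-- The Hessian bound `K` is independent of `η`; this is what later permits a passage to the limit.
-/
theorem exists_joint_subjets [FiniteDimensional ℝ E] [MeasurableSpace E] [BorelSpace E]
    [Nonempty ι] {t : ι → ℝ} (ht : ∀ i, 0 < t i)
    (hsum : ∑ i, t i = 1) {f : ι → E → ℝ} {δ C m : ℝ} (hδ : 0 < δ) (hC : 0 ≤ C)
    (hm : ∀ i x, m ≤ f i x) (hsc : ∀ i, MidpointSemiconcave C (f i))
    (hcont : ∀ i, Continuous (f i))
    {B : E →L[ℝ] E →L[ℝ] ℝ} (hB : ∀ x y, B x y = B y x)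
    (h : ∀ q : ι → E, weightedQuadratic t B (-(2 * δ)) q ≤ ∑ i, t i * f i (q i))
    (h0 : ∀ i, f i 0 ≤ 0) :
    ∃ K : ℝ, ∀ η : ℝ, 0 < η → ∃ (q : ι → E) (a : ι → E →L[ℝ] ℝ) (X : ι → E →L[ℝ] E →L[ℝ] ℝ),
      (∀ i, ‖q i‖ ≤ η) ∧ (∀ i, ‖a i‖ ≤ η) ∧ (∀ i, ‖X i‖ ≤ K) ∧ (∀ i x y, X i x y = X i y x) ∧
      ∑ i, t i * f i (q i) ≤ η ∧
      (∀ i, ∀ η' : ℝ, 0 < η' → ∀ᶠ y in 𝓝 (q i),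
        f i (q i) + a i (y - q i) + 1 / 2 * X i (y - q i) (y - q i) - η' * ‖y - q i‖ ^ 2
          ≤ f i y) ∧
      ∀ ζ, B ζ ζ - 4 * δ * ‖ζ‖ ^ 2 ≤ ∑ i, t i * X i ζ ζ := by
  classical
  -- Adding `M/2 ∑ t_i ‖q_i‖²` turns the coefficient `-4δ` into `‖B‖`, the value for which the
  -- quadratic function is convex.
  set M : ℝ := ‖B‖ + 4 * δ with hM
  have hM0 : 0 ≤ M := by positivity
  set g : ι → E → ℝ := fun i y => f i y + M / 2 * ‖y‖ ^ 2 with hg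
  have hgm : ∀ i y, m ≤ g i y := fun i y => by
    have := hm i y
    have : 0 ≤ M / 2 * ‖y‖ ^ 2 := by positivity
    simp only [hg]; linarith
  have hgs : ∀ i, MidpointSemiconcave (C + M) (g i) := by
    intro i x y
    have h1 := hsc i x y
    have h2 := parallelogram_law_with_norm ℝ x y
    have h3 : M * (‖x + y‖ ^ 2 + ‖x - y‖ ^ 2) = M * (2 * (‖x‖ ^ 2 + ‖y‖ ^ 2)) := by rw [h2]
    simp only [hg]
    linarith
  set e : ι → E → ℝ := fun i => convexMinorant (g i) with he
  have hec : ∀ i, ConvexOn ℝ Set.univ (e i) := fun i => convexOn_convexMinorant (hgm i)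
  have hes : ∀ i, MidpointSemiconcave (C + M) (e i) := fun i =>
    midpointSemiconcave_convexMinorant (hgm i) (hgs i)
  have heg : ∀ i y, e i y ≤ g i y := fun i y => convexMinorant_le (hgm i) y
  have hlip : ∀ i, LipschitzWith (Real.toNNReal (2 * (C + M))) (fderiv ℝ (e i)) := fun i =>
    (hec i).lipschitzWith_fderiv_of_semiconcave (by positivity) (hes i)
  -- the exceptional set
  set N : Set (ι → E) := {q | ¬ ∀ i, DifferentiableAt ℝ (fderiv ℝ (e i)) (q i)} with hN
  have hN0 : MeasureTheory.volume N = 0 := by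
    change ∀ᵐ q : ι → E, ∀ i, DifferentiableAt ℝ (fderiv ℝ (e i)) (q i)
    refine MeasureTheory.ae_all_iff.2 fun i => ?_
    exact (MeasureTheory.Measure.quasiMeasurePreserving_eval
      (fun _ : ι => (MeasureTheory.volume : MeasureTheory.Measure E)) i).ae
      ((hlip i).ae_differentiableAt)
  set D := InnerProductSpace.toDual ℝ E with hD
  set Lin : ι → (ι → E) →L[ℝ] (E →L[ℝ] ℝ) := fun i =>
    B.comp (∑ j, t j • ContinuousLinearMap.proj j)
      + ‖B‖ • (innerBilin E).comp (ContinuousLinearMap.proj i) with hLin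
  -- `T` recovers the perturbation `p` from the contact point `q`: there the gradients of the `e i`
  -- equal those of the touching function, whose constant part is `p`.
  set T : (ι → E) → (ι → E) := fun q i => D.symm (fderiv ℝ (e i) (q i) - Lin i q) with hT
  have hTlip : LipschitzWith (Real.toNNReal (2 * (C + M)) + ∑ j, ‖Lin j‖₊) T := by
    refine LipschitzWith.of_dist_le_mul fun x y => ?_
    refine (dist_pi_le_iff (by positivity)).2 fun i => ?_
    simp only [hT, LinearIsometryEquiv.dist_map]
    rw [dist_eq_norm]
    have h1 : ‖fderiv ℝ (e i) (x i) - fderiv ℝ (e i) (y i)‖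
        ≤ Real.toNNReal (2 * (C + M)) * dist x y := by
      rw [← dist_eq_norm]
      exact ((hlip i).dist_le_mul _ _).trans
        (mul_le_mul_of_nonneg_left (dist_le_pi_dist x y i) (NNReal.coe_nonneg _))
    have h2 : ‖Lin i (x - y)‖ ≤ (∑ j, ‖Lin j‖₊ : NNReal) * dist x y := by
      rw [dist_eq_norm]
      refine ((Lin i).le_opNorm _).trans (mul_le_mul_of_nonneg_right ?_ (norm_nonneg _))
      rw [← coe_nnnorm, NNReal.coe_le_coe]
      exact Finset.single_le_sum (f := fun j => ‖Lin j‖₊) (fun _ _ => zero_le)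
        (Finset.mem_univ i)
    have h3 : fderiv ℝ (e i) (x i) - Lin i x - (fderiv ℝ (e i) (y i) - Lin i y)
        = (fderiv ℝ (e i) (x i) - fderiv ℝ (e i) (y i)) - Lin i (x - y) := by
      rw [map_sub]; abel
    rw [h3, NNReal.coe_add, add_mul]
    exact (norm_sub_le _ _).trans (add_le_add h1 h2)
  refine ⟨2 * (C + M) + M, fun η hη => ?_⟩
  -- The gradients below are at most `‖B‖ρ + 4δρ + ρ`, and the value is at most `‖B‖ρ²/2 + ρ`.
  set ρ : ℝ := min 1 (η / (‖B‖ + 4 * δ + 2)) with hρ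
  have hρ0 : 0 < ρ := lt_min one_pos (by positivity)
  have hρ1 : ρ ≤ 1 := min_le_left _ _
  have hρη : (‖B‖ + 4 * δ + 2) * ρ ≤ η := by
    have := min_le_right 1 (η / (‖B‖ + 4 * δ + 2))
    rwa [← hρ, le_div_iff₀ (by positivity), mul_comm] at this
  obtain ⟨s, hs0, hsρ, hs⟩ := exists_perturbed_minimizer ht hsum hδ hcont B h h0 hρ0
  obtain ⟨p, hps, hpN⟩ := hTlip.exists_small_notMem_image MeasureTheory.volume hN0 hs0
  have hpi : ∀ i, ‖p i‖ ≤ s := fun i => (norm_le_pi_norm p i).trans hps.le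
  obtain ⟨q, hqρ, hqval, hqmin⟩ := hs p hpi
  have hval : ∑ i, t i * f i (q i) ≤ η := by
    have h1 := weightedQuadratic_le ht hsum B (c := -(4 * δ)) (by linarith) hqρ
    have h2 := sum_mul_inner_le ht hsum hs0.le hpi hqρ
    have h3 : ρ ^ 2 ≤ ρ := by nlinarith
    have h4 : s * ρ ≤ 1 * ρ := mul_le_mul_of_nonneg_right (hsρ.trans hρ1) hρ0.le
    have h5 := mul_le_mul_of_nonneg_left h3 (norm_nonneg B)
    have h6 := mul_nonneg (norm_nonneg B) hρ0.le
    have h7 := mul_nonneg hδ.le hρ0.le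
    linarith
  set b : E := ∑ j, t j • q j with hb
  have hb_le : ‖b‖ ≤ ρ := by
    calc ‖b‖ ≤ ∑ j, ‖t j • q j‖ := norm_sum_le _ _
      _ ≤ ∑ j, t j * ρ := Finset.sum_le_sum fun j _ => by
          rw [norm_smul, Real.norm_of_nonneg (ht j).le]
          exact mul_le_mul_of_nonneg_left (hqρ j) (ht j).le
      _ = ρ := by rw [← Finset.sum_mul, hsum, one_mul]
  -- the touching quadratic function
  set c₀ : ℝ := ∑ i, t i * f i (q i) - weightedQuadratic t B (-(4 * δ)) q
          - ∑ i, t i * inner ℝ (p i) (q i) with hc₀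
  set k : (ι → E) → ℝ := fun x =>
    c₀ + weightedQuadratic t B ‖B‖ x + ∑ i, t i * inner ℝ (p i) (x i) with hk
  set L : (ι → E) → ι → E →L[ℝ] ℝ := fun x i =>
    B (∑ j, t j • x j) + ‖B‖ • innerBilin E (x i) + innerBilin E (p i) with hL
  have hkadd : ∀ x d, k (x + d) = k x + ∑ i, t i * L x i (d i) + weightedQuadratic t B ‖B‖ d := by
    intro x d
    simp only [hk]
    rw [weightedQuadratic_add hB]
    have : ∑ i, t i * L x i (d i)
        = ∑ i, t i * (B (∑ j, t j • x j) (d i) + ‖B‖ * inner ℝ (x i) (d i))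
          + ∑ i, t i * inner ℝ (p i) (d i) := by
      rw [← Finset.sum_add_distrib]
      refine Finset.sum_congr rfl fun i _ => ?_
      simp only [hL, add_apply, smul_apply, innerBilin_apply, smul_eq_mul]
      ring
    rw [this]
    simp only [Pi.add_apply, inner_add_right, mul_add, Finset.sum_add_distrib]
    ring
  have hksup : ∀ x, ∃ L : ι → E →L[ℝ] ℝ, ∀ d, k x + ∑ i, t i * L i (d i) ≤ k (x + d) :=
    fun x => ⟨L x, fun d => by
      rw [hkadd]; linarith [weightedQuadratic_nonneg ht hsum B d]⟩
  have hgsum : ∀ x : ι → E, ∑ i, t i * g i (x i)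
      = ∑ i, t i * f i (x i) + M / 2 * ∑ i, t i * ‖x i‖ ^ 2 := by
    intro x
    rw [Finset.mul_sum, ← Finset.sum_add_distrib]
    exact Finset.sum_congr rfl fun i _ => by simp only [hg]; ring
  have hkg : ∀ x, k x ≤ ∑ i, t i * g i (x i) := by
    intro x
    have := hqmin x
    rw [hgsum]
    simp only [hk, hc₀, weightedQuadratic, hM] at this ⊢
    linarith
  have hkgq : k q = ∑ i, t i * g i (q i) := by
    rw [hgsum]
    simp only [hk, hc₀, weightedQuadratic, hM]
    ring
  have hke := sum_le_sum_convexMinorant ht hksup hkg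
  -- `k q ≤ ∑ t_i e_i(q_i) ≤ ∑ t_i g_i(q_i) = k q` and all weights are positive, so equality holds
  -- termwise.
  have heq : ∀ i, e i (q i) = g i (q i) := by
    have h1 : ∑ i, t i * e i (q i) = ∑ i, t i * g i (q i) :=
      le_antisymm (Finset.sum_le_sum fun i _ => mul_le_mul_of_nonneg_left (heg i _) (ht i).le)
        (hkgq ▸ hke q)
    intro i
    have h2 := (Finset.sum_eq_sum_iff_of_le
      (fun i _ => mul_le_mul_of_nonneg_left (heg i (q i)) (ht i).le)).1 h1 i (Finset.mem_univ i)
    exact mul_left_cancel₀ (ht i).ne' h2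
  have hkeq : k q = ∑ i, t i * e i (q i) := by
    rw [hkgq]; exact Finset.sum_congr rfl fun i _ => by rw [heq]
  -- Varying only the `i`-th variable shows that `L q i` is a subgradient of `e i`, and
  -- semiconcavity makes subgradients unique.
  have hder : ∀ i, fderiv ℝ (e i) (q i) = L q i := by
    intro i
    refine ((hes i).hasFDerivAt_of_subgradient fun y => ?_).fderiv
    have h1 := hke (q + Pi.single i (y - q i))
    rw [hkadd, hkeq, Finset.sum_eq_single (f := fun j => t j * L q j _) i
      (fun j _ hij => by simp [hij]) (by simp), Pi.single_eq_same] at h1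
    have h3 : ∑ j ∈ Finset.univ.erase i, t j * e j (q j + (Pi.single i (y - q i) : ι → E) j)
        = ∑ j ∈ Finset.univ.erase i, t j * e j (q j) :=
      Finset.sum_congr rfl fun j hj => by
        rw [Pi.single_eq_of_ne (Finset.ne_of_mem_erase hj), add_zero]
    have h4 := Finset.add_sum_erase Finset.univ
      (fun j => t j * e j (q j + (Pi.single i (y - q i) : ι → E) j)) (Finset.mem_univ i)
    have h5 := Finset.add_sum_erase Finset.univ (fun j => t j * e j (q j)) (Finset.mem_univ i)
    simp only [Pi.single_eq_same, add_sub_cancel] at h4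
    have h6 : ∑ j, t j * convexMinorant (g j) ((q + Pi.single i (y - q i) : ι → E) j)
        = ∑ j, t j * e j (q j + (Pi.single i (y - q i) : ι → E) j) := rfl
    have h2 := weightedQuadratic_nonneg ht hsum B (Pi.single i (y - q i))
    refine le_of_mul_le_mul_left ?_ (ht i)
    linarith
  have hTq : T q = p := by
    funext i
    simp only [hT, hder, hL, hLin]
    rw [LinearIsometryEquiv.symm_apply_eq]
    ext w
    simp [hD, innerBilin_apply]
  have hqN : ∀ i, DifferentiableAt ℝ (fderiv ℝ (e i)) (q i) := by
    by_contra hcon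
    exact hpN ⟨q, hcon, hTq⟩
  have hnear : ∀ i, ∀ᶠ y in 𝓝 (q i), DifferentiableAt ℝ (e i) y := fun i =>
    Eventually.of_forall fun y => ((hec i).hasFDerivAt_of_semiconcave (hes i) y).differentiableAt
  set Hs : ι → E →L[ℝ] E →L[ℝ] ℝ := fun i => fderiv ℝ (fderiv ℝ (e i)) (q i) with hHs
  have htaylor : ∀ i, ∀ η' : ℝ, 0 < η' → ∀ᶠ y in 𝓝 (q i),
      |e i y - (e i (q i) + fderiv ℝ (e i) (q i) (y - q i) + 1 / 2 * Hs i (y - q i) (y - q i))|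
        ≤ η' * ‖y - q i‖ ^ 2 := fun i η' hη' =>
    eventually_abs_sub_taylor_le (hnear i) (hqN i).hasFDerivAt hη'
  -- The subtracted terms are the derivatives of the quadratic `M/2 ‖y‖²` that was added to `f i`.
  refine ⟨q, fun i => L q i - M • innerBilin E (q i), fun i => Hs i - M • innerBilin E,
    fun i => ?_, fun i => ?_, fun i => ?_, fun i x y => ?_, ?_, fun i η' hη' => ?_, fun ζ => ?_⟩
  · refine (hqρ i).trans (le_trans ?_ hρη)
    nlinarith [norm_nonneg B]
  · have h1 : L q i - M • innerBilin E (q i) = B b - (4 * δ) • innerBilin E (q i) + innerBilin E (p i) := by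
      simp only [hL, hM, ← hb, add_smul]
      abel
    beta_reduce
    rw [h1]
    have h2 : ‖B b‖ ≤ ‖B‖ * ρ :=
      (B.le_opNorm b).trans (mul_le_mul_of_nonneg_left hb_le (norm_nonneg _))
    have h3 : ‖(4 * δ) • innerBilin E (q i)‖ ≤ 4 * δ * ρ := by
      rw [norm_smul, norm_innerBilin_apply, Real.norm_of_nonneg (by positivity)]
      exact mul_le_mul_of_nonneg_left (hqρ i) (by positivity)
    have h4 : ‖innerBilin E (p i)‖ ≤ ρ := by
      rw [norm_innerBilin_apply]
      exact (hpi i).trans hsρ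
    calc _ ≤ ‖B b‖ + ‖(4 * δ) • innerBilin E (q i)‖ + ‖innerBilin E (p i)‖ :=
          (norm_add_le _ _).trans (add_le_add (norm_sub_le _ _) le_rfl)
      _ ≤ η := by linarith
  · refine (norm_sub_le (Hs i) (M • innerBilin E)).trans (add_le_add ?_ ?_)
    · have := norm_fderiv_le_of_lipschitz ℝ (hlip i) (x₀ := q i)
      rwa [Real.coe_toNNReal _ (by positivity)] at this
    · exact norm_smul_innerBilin_le hM0
  · have h1 := second_derivative_symmetric_of_eventually
      ((hnear i).mono fun y hy => hy.hasFDerivAt) (hqN i).hasFDerivAt x y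
    simp only [sub_apply, smul_apply, innerBilin_apply, real_inner_comm x y]
    rw [h1]
  · exact hval
  · filter_upwards [htaylor i η' hη'] with y hy
    have h1 := (abs_le.1 hy).1
    have h2 := heg i y
    have h3 := heq i
    rw [hder] at h1
    simp only [hg] at h2 h3
    simp only [sub_apply, smul_apply, innerBilin_apply, smul_eq_mul]
    have h4 : ‖y‖ ^ 2 = ‖q i‖ ^ 2 + 2 * inner ℝ (q i) (y - q i) + ‖y - q i‖ ^ 2 := by
      rw [← norm_add_sq_real, add_sub_cancel]
    rw [real_inner_self_eq_norm_sq]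
    rw [h4] at h2
    linarith
  · have h1 := le_sum_of_weightedQuadratic_le ht hsum (c := ‖B‖)
      (fun i η' hη' => by simpa only [hder] using htaylor i η' hη')
      (fun d => by have := hke (q + d); rw [hkadd, hkeq] at this; exact this) ζ
    have h2 : ∑ i, t i * (Hs i - M • innerBilin E) ζ ζ = ∑ i, t i * Hs i ζ ζ - M * ‖ζ‖ ^ 2 := by
      have h3 : M * ‖ζ‖ ^ 2 = ∑ i, t i * (M * ‖ζ‖ ^ 2) := by
        rw [← Finset.sum_mul, hsum, one_mul]
      rw [h3, ← Finset.sum_sub_distrib]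
      refine Finset.sum_congr rfl fun i _ => ?_
      simp only [sub_apply, smul_apply, innerBilin_apply, smul_eq_mul,
        real_inner_self_eq_norm_sq]
      ring
    rw [h2, hM]
    linarith

end JointSubjets

/-! ### Regularisation by quadratic infimal convolution -/

section InfimalConvolutionOnBall

variable {E : Type*} [NormedAddCommGroup E] [InnerProductSpace ℝ E]

/-- The quadratic infimal convolution of the restriction of `g` to a ball around the origin. -/
noncomputable def ballInfConv (r c : ℝ) (g : E → ℝ) (q : E) : ℝ :=
  sInf ((fun z => g z + c / 2 * ‖z - q‖ ^ 2) '' Metric.closedBall 0 r)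

variable [FiniteDimensional ℝ E] {r c : ℝ} {g : E → ℝ}

theorem exists_ballInfConv_eq (hr : 0 ≤ r) (hg : ContinuousOn g (Metric.closedBall 0 r)) (q : E) :
    ∃ z ∈ Metric.closedBall (0 : E) r, ballInfConv r c g q = g z + c / 2 * ‖z - q‖ ^ 2 ∧
      ∀ y ∈ Metric.closedBall (0 : E) r, ballInfConv r c g q ≤ g y + c / 2 * ‖y - q‖ ^ 2 := by
  obtain ⟨z, hz, hmin⟩ := (isCompact_closedBall (0 : E) r).exists_isMinOn
    ⟨0, Metric.mem_closedBall_self hr⟩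
    (f := fun z => g z + c / 2 * ‖z - q‖ ^ 2) (hg.add (by fun_prop))
  have hleast : IsLeast ((fun z => g z + c / 2 * ‖z - q‖ ^ 2) '' Metric.closedBall 0 r)
      (g z + c / 2 * ‖z - q‖ ^ 2) := by
    refine ⟨⟨z, hz, rfl⟩, ?_⟩
    rintro _ ⟨y, hy, rfl⟩
    exact hmin hy
  have heq : ballInfConv r c g q = g z + c / 2 * ‖z - q‖ ^ 2 := hleast.csInf_eq
  exact ⟨z, hz, heq, fun y hy => heq ▸ hmin hy⟩

/-- An infimum of paraboloids of the same opening; a minimiser for `x` is a competitor for `x + h`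
and `x - h`. -/
theorem midpointSemiconcave_ballInfConv (hr : 0 ≤ r)
    (hg : ContinuousOn g (Metric.closedBall 0 r)) :
    MidpointSemiconcave c (ballInfConv r c g) := by
  intro x h
  obtain ⟨z, hz, heq, -⟩ := exists_ballInfConv_eq (c := c) hr hg x
  obtain ⟨-, -, -, h1⟩ := exists_ballInfConv_eq (c := c) hr hg (x + h)
  obtain ⟨-, -, -, h2⟩ := exists_ballInfConv_eq (c := c) hr hg (x - h)
  have h1 := h1 z hz
  have h2 := h2 z hz
  have h3 := parallelogram_law_with_norm ℝ (z - x) h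
  have h4 : c / 2 * (‖z - x + h‖ ^ 2 + ‖z - x - h‖ ^ 2)
      = c / 2 * (2 * (‖z - x‖ ^ 2 + ‖h‖ ^ 2)) := by rw [h3]
  have e1 : z - (x + h) = z - x - h := by abel
  have e2 : z - (x - h) = z - x + h := by abel
  rw [e1] at h1
  rw [e2] at h2
  linarith

theorem continuous_ballInfConv (hr : 0 ≤ r) (hc : 0 ≤ c)
    (hg : ContinuousOn g (Metric.closedBall 0 r)) : Continuous (ballInfConv r c g) := by
  have key : ∀ x y, ballInfConv r c g x - ballInfConv r c g y
      ≤ c / 2 * (‖x - y‖ * (2 * r + ‖x‖ + ‖y‖)) := by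
    intro x y
    obtain ⟨z, hz, heq, -⟩ := exists_ballInfConv_eq (c := c) hr hg y
    obtain ⟨-, -, -, h1⟩ := exists_ballInfConv_eq (c := c) hr hg x
    have h1 := h1 z hz
    rw [mem_closedBall_zero_iff] at hz
    have h2 : ‖z - x‖ ^ 2 - ‖z - y‖ ^ 2 ≤ ‖x - y‖ * (2 * r + ‖x‖ + ‖y‖) := by
      have h3 : ‖z - x‖ ≤ r + ‖x‖ := (norm_sub_le _ _).trans (by linarith)
      have h4 : ‖z - y‖ ≤ r + ‖y‖ := (norm_sub_le _ _).trans (by linarith)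
      have h5 : ‖z - x‖ - ‖z - y‖ ≤ ‖x - y‖ := by
        have := norm_sub_norm_le (z - x) (z - y)
        rwa [sub_sub_sub_cancel_left, norm_sub_rev y x] at this
      have h6 : 0 ≤ ‖z - x‖ + ‖z - y‖ := by positivity
      calc _ = (‖z - x‖ - ‖z - y‖) * (‖z - x‖ + ‖z - y‖) := by ring
        _ ≤ ‖x - y‖ * (‖z - x‖ + ‖z - y‖) := mul_le_mul_of_nonneg_right h5 h6
        _ ≤ _ := mul_le_mul_of_nonneg_left (by linarith) (norm_nonneg _)
    have h3 := mul_le_mul_of_nonneg_left h2 (by linarith : 0 ≤ c / 2)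
    linarith
  refine continuous_iff_continuousAt.2 fun y => ?_
  rw [ContinuousAt, tendsto_iff_dist_tendsto_zero]
  have hlim : Tendsto (fun x => c / 2 * (‖x - y‖ * (2 * r + ‖x‖ + ‖y‖))) (𝓝 y) (𝓝 0) := by
    have : Continuous fun x => c / 2 * (‖x - y‖ * (2 * r + ‖x‖ + ‖y‖)) := by fun_prop
    simpa using this.tendsto y
  refine squeeze_zero (fun _ => dist_nonneg) (fun x => ?_) hlim
  rw [Real.dist_eq, abs_le]
  have h1 := key x y
  have h2 := key y x
  rw [norm_sub_rev y x, add_right_comm] at h2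
  constructor <;> linarith

/-- A subjet of the infimal convolution at `q` transfers unchanged to `g` at the minimiser `z`: use
`y` as competitor at `q + (y - z)`, so that the penalty stays `c/2 ‖z - q‖²`. -/
theorem eventually_quadratic_le_of_ballInfConv {q z : E} (hr : 0 ≤ r)
    (hg : ContinuousOn g (Metric.closedBall 0 r)) (hz : ‖z‖ < r)
    (hqz : ballInfConv r c g q = g z + c / 2 * ‖z - q‖ ^ 2) {a : E →L[ℝ] ℝ}
    {X : E →L[ℝ] E →L[ℝ] ℝ} {η : ℝ}
    (h : ∀ᶠ y in 𝓝 q, ballInfConv r c g q + a (y - q) + 1 / 2 * X (y - q) (y - q)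
      - η * ‖y - q‖ ^ 2 ≤ ballInfConv r c g y) :
    ∀ᶠ y in 𝓝 z, g z + a (y - z) + 1 / 2 * X (y - z) (y - z) - η * ‖y - z‖ ^ 2 ≤ g y := by
  have hlim : Tendsto (fun y => q + (y - z)) (𝓝 z) (𝓝 q) := by
    have : Continuous fun y => q + (y - z) := by fun_prop
    simpa using this.tendsto z
  filter_upwards [hlim.eventually h,
    Metric.isOpen_ball.mem_nhds (mem_ball_zero_iff.2 hz)] with y hy hyr
  obtain ⟨-, -, -, h1⟩ := exists_ballInfConv_eq (c := c) hr hg (q + (y - z))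
  have h1 := h1 y (Metric.ball_subset_closedBall hyr)
  rw [add_sub_cancel_left, hqz] at hy
  have : y - (q + (y - z)) = z - q := by abel
  rw [this] at h1
  linarith

end InfimalConvolutionOnBall

/-! ### Joint subjets of continuous functions -/

section JointSubjets

variable {ι E : Type*} [Fintype ι] [NormedAddCommGroup E] [InnerProductSpace ℝ E]

/-- Expand at `q` and split the cross term by Young's inequality, at the cost `δ‖∑ t_i q_i‖²`. The
`+ 1` in the penalty constant leaves the surplus on the left, which later keeps minimisers near `q`.
-/
theorem weightedQuadratic_le_add {t : ι → ℝ} (ht : ∀ i, 0 < t i) (hsum : ∑ i, t i = 1)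
    {B : E →L[ℝ] E →L[ℝ] ℝ} (hB : ∀ x y, B x y = B y x) {δ : ℝ} (hδ : 0 < δ) (q z : ι → E) :
    weightedQuadratic t B (-(2 * δ)) q + 1 / 2 * ∑ i, t i * ‖z i - q i‖ ^ 2
      ≤ weightedQuadratic t B 0 z
        + (‖B‖ ^ 2 / (2 * δ) + ‖B‖ + 1) / 2 * ∑ i, t i * ‖z i - q i‖ ^ 2 := by
  have h1 := weightedQuadratic_add hB (t := t) 0 q (z - q)
  rw [add_sub_cancel] at h1
  rw [h1]
  have h2 : ∑ i, t i * (B (∑ j, t j • q j) ((z - q) i) + 0 * inner ℝ (q i) ((z - q) i))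
      = B (∑ j, t j • q j) (∑ i, t i • (z i - q i)) := by
    generalize ∑ j, t j • q j = b
    rw [map_sum]
    refine Finset.sum_congr rfl fun i _ => ?_
    rw [map_smul, smul_eq_mul, Pi.sub_apply]
    ring
  rw [h2]
  simp only [weightedQuadratic, Pi.sub_apply]
  have h3 := norm_sq_sum_smul_le ht hsum q
  have h4 := norm_sq_sum_smul_le ht hsum (fun i => z i - q i)
  set b := ∑ j, t j • q j
  set d := ∑ i, t i • (z i - q i)
  set Sq := ∑ i, t i * ‖q i‖ ^ 2
  set Sd := ∑ i, t i * ‖z i - q i‖ ^ 2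
  have h5 := (abs_le.1 (abs_bilin_le B b d)).1
  have h6 := (abs_le.1 (abs_bilin_self_le B d)).1
  have h7 : ‖B‖ * ‖b‖ * ‖d‖ ≤ δ * ‖b‖ ^ 2 + ‖B‖ ^ 2 / (4 * δ) * ‖d‖ ^ 2 := by
    have : δ * ‖b‖ ^ 2 + ‖B‖ ^ 2 / (4 * δ) * ‖d‖ ^ 2 - ‖B‖ * ‖b‖ * ‖d‖
        = δ * (‖b‖ - ‖B‖ / (2 * δ) * ‖d‖) ^ 2 := by
      field_simp
      ring
    have h8 : 0 ≤ δ * (‖b‖ - ‖B‖ / (2 * δ) * ‖d‖) ^ 2 := by positivity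
    linarith
  have h8 := mul_le_mul_of_nonneg_left h3 hδ.le
  have h9 := mul_le_mul_of_nonneg_left h4 (by positivity : 0 ≤ ‖B‖ ^ 2 / (4 * δ) + ‖B‖ / 2)
  have h10 : (‖B‖ ^ 2 / (2 * δ) + ‖B‖ + 1) / 2 * Sd
      = (‖B‖ ^ 2 / (4 * δ) + ‖B‖ / 2) * Sd + 1 / 2 * Sd := by
    field_simp
    ring
  rw [h10]
  linarith

theorem exists_joint_subjets_of_continuousOn [FiniteDimensional ℝ E] [MeasurableSpace E]
    [BorelSpace E] [Nonempty ι] {t : ι → ℝ} (ht : ∀ i, 0 < t i)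
    (hsum : ∑ i, t i = 1) {g : ι → E → ℝ} {r δ : ℝ} (hr : 0 < r) (hδ : 0 < δ)
    (hg : ∀ i, ContinuousOn (g i) (Metric.closedBall 0 r)) (hg0 : ∀ i, g i 0 = 0)
    {B : E →L[ℝ] E →L[ℝ] ℝ} (hB : ∀ x y, B x y = B y x)
    (h : ∀ z : ι → E, (∀ i, ‖z i‖ ≤ r) → weightedQuadratic t B 0 z ≤ ∑ i, t i * g i (z i)) :
    ∃ K : ℝ, ∀ η : ℝ, 0 < η → ∃ (z : ι → E) (a : ι → E →L[ℝ] ℝ) (X : ι → E →L[ℝ] E →L[ℝ] ℝ),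
      (∀ i, ‖z i‖ ≤ η) ∧ (∀ i, ‖a i‖ ≤ η) ∧ (∀ i, ‖X i‖ ≤ K) ∧ (∀ i x y, X i x y = X i y x) ∧
      (∀ i, ∀ η' : ℝ, 0 < η' → ∀ᶠ y in 𝓝 (z i),
        g i (z i) + a i (y - z i) + 1 / 2 * X i (y - z i) (y - z i) - η' * ‖y - z i‖ ^ 2
          ≤ g i y) ∧
      ∀ ζ, B ζ ζ - 4 * δ * ‖ζ‖ ^ 2 ≤ ∑ i, t i * X i ζ ζ := by
  set c : ℝ := ‖B‖ ^ 2 / (2 * δ) + ‖B‖ + 1 with hc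
  have hc0 : 0 ≤ c := by positivity
  set f : ι → E → ℝ := fun i => ballInfConv r c (g i) with hf
  have hz : ∀ q : ι → E, ∃ z : ι → E, ∀ i, ‖z i‖ ≤ r ∧
      f i (q i) = g i (z i) + c / 2 * ‖z i - q i‖ ^ 2 := by
    intro q
    choose z hz heq _ using fun i => exists_ballInfConv_eq (c := c) hr.le (hg i) (q i)
    exact ⟨z, fun i => ⟨mem_closedBall_zero_iff.1 (hz i), heq i⟩⟩
  have hbelow : ∀ (q z : ι → E), (∀ i, ‖z i‖ ≤ r ∧
      f i (q i) = g i (z i) + c / 2 * ‖z i - q i‖ ^ 2) →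
      weightedQuadratic t B (-(2 * δ)) q + 1 / 2 * ∑ i, t i * ‖z i - q i‖ ^ 2
        ≤ ∑ i, t i * f i (q i) := by
    intro q z hz
    have h1 := h z fun i => (hz i).1
    have h2 := weightedQuadratic_le_add ht hsum hB hδ q z
    have h3 : ∑ i, t i * f i (q i)
        = ∑ i, t i * g i (z i) + c / 2 * ∑ i, t i * ‖z i - q i‖ ^ 2 := by
      rw [Finset.mul_sum, ← Finset.sum_add_distrib]
      exact Finset.sum_congr rfl fun i _ => by rw [(hz i).2]; ring
    linarith
  have hm : ∃ m : ℝ, ∀ i x, m ≤ f i x := by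
    have h1 : ∀ i, ∃ m : ℝ, ∀ x ∈ Metric.closedBall (0 : E) r, m ≤ g i x := fun i => by
      obtain ⟨m, hm⟩ := (isCompact_closedBall (0 : E) r).bddBelow_image (hg i)
      exact ⟨m, fun x hx => hm ⟨x, hx, rfl⟩⟩
    choose m hm using h1
    obtain ⟨i₀, hi₀⟩ := Finite.exists_min m
    refine ⟨m i₀, fun i x => ?_⟩
    obtain ⟨z, hz, heq, -⟩ := exists_ballInfConv_eq (c := c) hr.le (hg i) x
    simp only [hf, heq]
    have h2 := hm i z hz
    have h3 : 0 ≤ c / 2 * ‖z - x‖ ^ 2 := by positivity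
    linarith [hi₀ i]
  obtain ⟨m, hm⟩ := hm
  obtain ⟨K, hK⟩ := exists_joint_subjets ht hsum hδ hc0 hm
    (fun i => midpointSemiconcave_ballInfConv hr.le (hg i))
    (fun i => continuous_ballInfConv hr.le hc0 (hg i)) hB
    (fun q => by
      obtain ⟨z, hz⟩ := hz q
      have h1 := hbelow q z hz
      have h2 : 0 ≤ ∑ i, t i * ‖z i - q i‖ ^ 2 :=
        Finset.sum_nonneg fun i _ => mul_nonneg (ht i).le (sq_nonneg _)
      linarith)
    (fun i => by
      obtain ⟨-, -, -, h1⟩ := exists_ballInfConv_eq (c := c) hr.le (hg i) 0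
      have h1 := h1 0 (Metric.mem_closedBall_self hr.le)
      simpa [hg0] using h1)
  refine ⟨K, fun η hη => ?_⟩
  obtain ⟨i₀, hi₀⟩ := Finite.exists_min t
  have hτ0 := ht i₀
  set A : ℝ := 1 + ‖B‖ / 2 + δ with hA
  have hA0 : 0 < A := by positivity
  set η₁ : ℝ := min η (r / 2) with hη₁
  have hη₁0 : 0 < η₁ := lt_min hη (by positivity)
  -- The surplus gives `∑ t_i ‖z_i - q_i‖² ≤ 2Aκ`, so `8Aκ ≤ t_{i₀} η₁²` yields `‖z_i - q_i‖ ≤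
  -- η₁/2`.
  set κ : ℝ := min (min 1 (η₁ / 2)) (t i₀ * η₁ ^ 2 / (8 * A)) with hκ
  have hκ0 : 0 < κ := lt_min (lt_min one_pos (by positivity)) (by positivity)
  have hκ1 : κ ≤ 1 := (min_le_left _ _).trans (min_le_left _ _)
  have hκ2 : κ ≤ η₁ / 2 := (min_le_left _ _).trans (min_le_right _ _)
  have hκ3 : 8 * A * κ ≤ t i₀ * η₁ ^ 2 := by
    have : κ ≤ t i₀ * η₁ ^ 2 / (8 * A) := min_le_right _ _
    rwa [le_div_iff₀ (by positivity), mul_comm] at this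
  obtain ⟨q, a, X, hq, ha, hX, hXs, hval, hsub, hsec⟩ := hK κ hκ0
  obtain ⟨z, hz⟩ := hz q
  have hzq : ∀ i, ‖z i - q i‖ ≤ η₁ / 2 := by
    intro i
    have h1 := hbelow q z hz
    have h2 : -(‖B‖ / 2 + δ) * κ ^ 2 ≤ weightedQuadratic t B (-(2 * δ)) q := by
      have h3 := (abs_le.1 (abs_bilin_self_le B (∑ i, t i • q i))).1
      have h4 := norm_sq_sum_smul_le ht hsum q
      have h5 : ∑ i, t i * ‖q i‖ ^ 2 ≤ κ ^ 2 := by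
        calc ∑ i, t i * ‖q i‖ ^ 2 ≤ ∑ i, t i * κ ^ 2 := by
              refine Finset.sum_le_sum fun i _ => mul_le_mul_of_nonneg_left ?_ (ht i).le
              exact pow_le_pow_left₀ (norm_nonneg _) (hq i) 2
          _ = κ ^ 2 := by rw [← Finset.sum_mul, hsum, one_mul]
      have h6 := mul_le_mul_of_nonneg_left (h4.trans h5) (norm_nonneg B)
      have h7 := mul_le_mul_of_nonneg_left h5 hδ.le
      rw [weightedQuadratic]
      linarith
    have h3 : κ ^ 2 ≤ κ := by nlinarith
    have h4 := mul_le_mul_of_nonneg_left h3 (by positivity : 0 ≤ ‖B‖ / 2 + δ)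
    have h5 : t i * ‖z i - q i‖ ^ 2 ≤ ∑ i, t i * ‖z i - q i‖ ^ 2 :=
      Finset.single_le_sum (f := fun i => t i * ‖z i - q i‖ ^ 2)
        (fun i _ => mul_nonneg (ht i).le (sq_nonneg _)) (Finset.mem_univ i)
    have h6 := mul_le_mul_of_nonneg_right (hi₀ i) (sq_nonneg ‖z i - q i‖)
    have h7 : t i₀ * ‖z i - q i‖ ^ 2 ≤ t i₀ * (η₁ / 2) ^ 2 := by
      simp only [hA] at hκ3
      linarith
    have h8 := le_of_mul_le_mul_left h7 hτ0
    exact (pow_le_pow_iff_left₀ (norm_nonneg _) (by positivity) two_ne_zero).1 h8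
  have hzη : ∀ i, ‖z i‖ ≤ η₁ := fun i => by
    have h1 := norm_add_le (q i) (z i - q i)
    rw [add_sub_cancel] at h1
    linarith [hq i, hzq i]
  have hη₁r : η₁ < r := (min_le_right _ _).trans_lt (by linarith)
  have hκη : κ ≤ η := by
    have : η₁ ≤ η := min_le_left _ _
    linarith
  exact ⟨z, a, X, fun i => (hzη i).trans (min_le_left _ _), fun i => (ha i).trans hκη, hX, hXs,
    fun i η' hη' => eventually_quadratic_le_of_ballInfConv hr.le (hg i)
      ((hzη i).trans_lt hη₁r) (hz i).2 (hsub i η' hη'), hsec⟩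

end JointSubjets

/-! ### Compactness of bounded families of forms -/

section Subsequences

variable {ι E : Type*} [NormedAddCommGroup E] [InnerProductSpace ℝ E]

theorem exists_subseq_tendsto_pi [Finite ι] {V : Type*} [NormedAddCommGroup V] [NormedSpace ℝ V]
    [FiniteDimensional ℝ V] {X : ℕ → ι → V} {K : ℝ} (hX : ∀ m i, ‖X m i‖ ≤ K) :
    ∃ (Y : ι → V) (s : ℕ → ℕ), StrictMono s ∧
      ∀ i, Tendsto (fun m => X (s m) i) atTop (𝓝 (Y i)) := by
  have := FiniteDimensional.proper_real V
  obtain ⟨Y, -, s, hs, hlim⟩ := (isCompact_univ_pi fun _ : ι =>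
    isCompact_closedBall (0 : V) K).tendsto_subseq (x := X)
      fun m i _ => mem_closedBall_zero_iff.2 (hX m i)
  exact ⟨Y, s, hs, fun i => (tendsto_pi_nhds.1 hlim) i⟩

theorem exists_subseq_tendsto_bilin [Finite ι] [FiniteDimensional ℝ E]
    {X : ℕ → ι → E →L[ℝ] E →L[ℝ] ℝ} {K : ℝ} (hX : ∀ m i, ‖X m i‖ ≤ K) :
    ∃ (Y : ι → E →L[ℝ] E →L[ℝ] ℝ) (s : ℕ → ℕ), StrictMono s ∧
      ∀ i x y, Tendsto (fun m => X (s m) i x y) atTop (𝓝 (Y i x y)) := by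
  obtain ⟨Y, s, hs, hlim⟩ := exists_subseq_tendsto_pi (V := E →L[ℝ] E →L[ℝ] ℝ) hX
  refine ⟨Y, s, hs, fun i x y => ?_⟩
  have h1 : Continuous fun A : E →L[ℝ] E →L[ℝ] ℝ => A x y := by fun_prop
  exact (h1.tendsto (Y i)).comp (hlim i)

end Subsequences

/-! ### Bilinear forms and symmetric matrices -/

section BilinMatrix

variable {n : ℕ}

/-- The matrix of a bilinear form in the standard basis. -/
noncomputable def bilinMatrix
    (B : EuclideanSpace ℝ (Fin n) →L[ℝ] EuclideanSpace ℝ (Fin n) →L[ℝ] ℝ) :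
    Matrix (Fin n) (Fin n) ℝ :=
  Matrix.of fun i j => B (EuclideanSpace.single i 1) (EuclideanSpace.single j 1)

theorem tendsto_bilinMatrix {β : Type*} {L : Filter β}
    {A : β → EuclideanSpace ℝ (Fin n) →L[ℝ] EuclideanSpace ℝ (Fin n) →L[ℝ] ℝ}
    {B : EuclideanSpace ℝ (Fin n) →L[ℝ] EuclideanSpace ℝ (Fin n) →L[ℝ] ℝ}
    (h : ∀ x y, Tendsto (fun b => A b x y) L (𝓝 (B x y))) :
    Tendsto (fun b => bilinMatrix (A b)) L (𝓝 (bilinMatrix B)) :=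
  tendsto_pi_nhds.2 fun _ => tendsto_pi_nhds.2 fun _ => h _ _

theorem isSymm_bilinMatrix
    {B : EuclideanSpace ℝ (Fin n) →L[ℝ] EuclideanSpace ℝ (Fin n) →L[ℝ] ℝ}
    (hB : ∀ x y, B x y = B y x) : (bilinMatrix B).IsSymm := by
  ext i j
  exact hB _ _

theorem bilinMatrix_sub (A B : EuclideanSpace ℝ (Fin n) →L[ℝ] EuclideanSpace ℝ (Fin n) →L[ℝ] ℝ) :
    bilinMatrix (A - B) = bilinMatrix A - bilinMatrix B := by
  ext i j; simp [bilinMatrix]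

theorem bilinMatrix_smul (c : ℝ)
    (B : EuclideanSpace ℝ (Fin n) →L[ℝ] EuclideanSpace ℝ (Fin n) →L[ℝ] ℝ) :
    bilinMatrix (c • B) = c • bilinMatrix B := by
  ext i j; simp [bilinMatrix]

theorem bilinMatrix_sum {ι : Type*} (s : Finset ι)
    (B : ι → EuclideanSpace ℝ (Fin n) →L[ℝ] EuclideanSpace ℝ (Fin n) →L[ℝ] ℝ) :
    bilinMatrix (∑ i ∈ s, B i) = ∑ i ∈ s, bilinMatrix (B i) := by
  ext i j; simp [bilinMatrix, Matrix.sum_apply]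

theorem bilin_eq_dotProduct_mulVec
    (B : EuclideanSpace ℝ (Fin n) →L[ℝ] EuclideanSpace ℝ (Fin n) →L[ℝ] ℝ)
    (x y : EuclideanSpace ℝ (Fin n)) : B x y = x.ofLp ⬝ᵥ (bilinMatrix B).mulVec y.ofLp := by
  have hrep : ∀ z : EuclideanSpace ℝ (Fin n), z = ∑ i, z i • EuclideanSpace.single i (1 : ℝ) := by
    intro z
    simpa using ((EuclideanSpace.basisFun (Fin n) ℝ).sum_repr z).symm
  conv_lhs => rw [hrep x, hrep y]
  simp only [map_sum, map_smul, smul_apply, smul_eq_mul, dotProduct, Matrix.mulVec,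
    bilinMatrix, Matrix.of_apply, sum_apply, Finset.mul_sum]
  rw [Finset.sum_comm]
  exact Finset.sum_congr rfl fun i _ => Finset.sum_congr rfl fun j _ => by ring

theorem posSemidef_bilinMatrix
    {B : EuclideanSpace ℝ (Fin n) →L[ℝ] EuclideanSpace ℝ (Fin n) →L[ℝ] ℝ}
    (hB : ∀ x y, B x y = B y x) (hpos : ∀ x, 0 ≤ B x x) : (bilinMatrix B).PosSemidef := by
  refine Matrix.PosSemidef.of_dotProduct_mulVec_nonneg ?_ fun x => ?_
  · rw [Matrix.IsHermitian, Matrix.conjTranspose_eq_transpose_of_trivial]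
    exact isSymm_bilinMatrix hB
  · have := hpos (WithLp.toLp 2 x)
    rw [bilin_eq_dotProduct_mulVec] at this
    simpa using this

end BilinMatrix

/-! ### From local quadratic bounds to global test functions -/

section TestFunctions

variable {n : ℕ}

/-- A quartic correction leaves the second-order jet at `x` unchanged and, as `u` is bounded below,
pushes the polynomial under `u` on all of `Ω`. -/
theorem exists_test_function {Ω : Set (EuclideanSpace ℝ (Fin n))}
    {u : EuclideanSpace ℝ (Fin n) → ℝ} {m : ℝ} (hm : ∀ y ∈ Ω, m ≤ u y)
    {x ξ : EuclideanSpace ℝ (Fin n)}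
    {X : EuclideanSpace ℝ (Fin n) →L[ℝ] EuclideanSpace ℝ (Fin n) →L[ℝ] ℝ}
    (hX : ∀ y z, X y z = X z y)
    (hloc : ∀ᶠ y in 𝓝 x, y ∈ Ω →
      u x + inner ℝ ξ (y - x) + 1 / 2 * X (y - x) (y - x) ≤ u y) :
    ∃ φ : EuclideanSpace ℝ (Fin n) → ℝ, ContDiff ℝ ∞ φ ∧ TouchesFromBelow Ω φ u x ∧
      gradient φ x = ξ ∧ hessianMatrix φ x = bilinMatrix X := by
  obtain ⟨ρ, hρ, hball⟩ := Metric.eventually_nhds_iff_ball.1 hloc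
  -- The three summands dominate the linear, quadratic and constant terms when `‖y - x‖ ≥ ρ`.
  set C : ℝ := ‖ξ‖ / ρ ^ 3 + ‖X‖ / 2 / ρ ^ 2 + |m - u x| / ρ ^ 4 with hC
  have hC0 : 0 ≤ C := by positivity
  set φ : EuclideanSpace ℝ (Fin n) → ℝ := fun y =>
    u x + innerBilin _ ξ (y - x) + 1 / 2 * X (y - x) (y - x) - C * (‖y - x‖ ^ 2) ^ 2 with hφ
  have hsub : ∀ y, HasFDerivAt (fun y : EuclideanSpace ℝ (Fin n) => y - x)
      (ContinuousLinearMap.id ℝ _) y := fun y => (hasFDerivAt_id y).sub_const x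
  have hcomp : ∀ {V : Type} [NormedAddCommGroup V] [NormedSpace ℝ V]
      (A : EuclideanSpace ℝ (Fin n) →L[ℝ] V) (y : EuclideanSpace ℝ (Fin n)),
      HasFDerivAt (fun y => A (y - x)) A y := fun A y =>
    (A.hasFDerivAt.comp y (hsub y)).congr_fderiv (ContinuousLinearMap.comp_id _)
  have hnsq : ∀ y, HasFDerivAt (fun y : EuclideanSpace ℝ (Fin n) => ‖y - x‖ ^ 2)
      ((2 : ℝ) • innerBilin _ (y - x)) y := by
    intro y
    refine (hsub y).norm_sq.congr_fderiv ?_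
    ext w
    simp [innerBilin_apply]
  set D : EuclideanSpace ℝ (Fin n) → EuclideanSpace ℝ (Fin n) →L[ℝ] ℝ := fun y =>
    innerBilin _ ξ + X (y - x) - (C * (4 * ‖y - x‖ ^ 2)) • innerBilin _ (y - x) with hD
  have hder : ∀ y, HasFDerivAt φ (D y) y := by
    intro y
    have h1 := (((hasFDerivAt_const (u x) y).add (hcomp (innerBilin _ ξ) y)).add
      (((hcomp X y).clm_apply (hsub y)).const_mul (1 / 2))).sub
      (((hnsq y).pow 2).const_mul C)
    refine h1.congr_fderiv ?_
    ext w
    have := hX w (y - x)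
    simp [hD] at this ⊢
    linarith
  have hfd : fderiv ℝ φ = D := funext fun y => (hder y).fderiv
  have hder2 : HasFDerivAt D X x := by
    have h1 : HasFDerivAt (fun y : EuclideanSpace ℝ (Fin n) => C * (4 * ‖y - x‖ ^ 2))
        (C • (4 : ℝ) • (2 : ℝ) • innerBilin _ (x - x)) x :=
      ((hnsq x).const_mul 4).const_mul C
    have h2 := ((hasFDerivAt_const (innerBilin _ ξ) x).add (hcomp X x)).sub
      (h1.smul (hcomp (innerBilin (EuclideanSpace ℝ (Fin n))) x))
    refine h2.congr_fderiv ?_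
    ext w z
    simp
  have hcd : ContDiff ℝ ∞ φ := by
    have h1 : ContDiff ℝ ∞ fun y : EuclideanSpace ℝ (Fin n) => y - x :=
      contDiff_id.sub contDiff_const
    have h2 : ContDiff ℝ ∞ fun y : EuclideanSpace ℝ (Fin n) => X (y - x) (y - x) :=
      (X.contDiff.comp h1).clm_apply h1
    have h3 : ContDiff ℝ ∞ fun y : EuclideanSpace ℝ (Fin n) => innerBilin _ ξ (y - x) :=
      (innerBilin _ ξ).contDiff.comp h1
    exact ((contDiff_const.add h3).add (contDiff_const.mul h2)).sub
      (contDiff_const.mul ((h1.norm_sq ℝ).pow 2))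
  refine ⟨φ, hcd, ⟨by simp [hφ], fun y hy => ?_⟩, ?_, ?_⟩
  · by_cases hyρ : y ∈ Metric.ball x ρ
    · have h1 := hball y hyρ hy
      have h2 : 0 ≤ C * (‖y - x‖ ^ 2) ^ 2 := by positivity
      simp only [hφ, innerBilin_apply]
      linarith
    · have hs : ρ ≤ ‖y - x‖ := by
        rwa [mem_ball_iff_norm, not_lt] at hyρ
      set s := ‖y - x‖ with hs'
      have hs0 : 0 ≤ s := norm_nonneg _
      have h1 : innerBilin _ ξ (y - x) ≤ ‖ξ‖ * s := by
        rw [innerBilin_apply]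
        exact real_inner_le_norm _ _
      have h2 := (abs_le.1 (abs_bilin_self_le X (y - x))).2
      have h3 : ‖ξ‖ * s ≤ ‖ξ‖ / ρ ^ 3 * s ^ 4 := by
        rw [div_mul_eq_mul_div, le_div_iff₀ (by positivity)]
        have : ρ ^ 3 ≤ s ^ 3 := pow_le_pow_left₀ hρ.le hs 3
        have := mul_le_mul_of_nonneg_left this (mul_nonneg (norm_nonneg ξ) hs0)
        linarith
      have h4 : ‖X‖ / 2 * s ^ 2 ≤ ‖X‖ / 2 / ρ ^ 2 * s ^ 4 := by
        rw [div_mul_eq_mul_div _ (ρ ^ 2), le_div_iff₀ (by positivity)]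
        have : ρ ^ 2 ≤ s ^ 2 := pow_le_pow_left₀ hρ.le hs 2
        have := mul_le_mul_of_nonneg_left this
          (mul_nonneg (by positivity : 0 ≤ ‖X‖ / 2) (sq_nonneg s))
        linarith
      have h5 : |m - u x| ≤ |m - u x| / ρ ^ 4 * s ^ 4 := by
        rw [div_mul_eq_mul_div, le_div_iff₀ (by positivity)]
        exact mul_le_mul_of_nonneg_left (pow_le_pow_left₀ hρ.le hs 4) (abs_nonneg _)
      have h6 := (abs_le.1 (le_refl |m - u x|)).1
      have h7 := hm y hy
      have h8 : C * (s ^ 2) ^ 2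
          = ‖ξ‖ / ρ ^ 3 * s ^ 4 + ‖X‖ / 2 / ρ ^ 2 * s ^ 4 + |m - u x| / ρ ^ 4 * s ^ 4 := by
        rw [hC]; ring
      simp only [hφ]
      rw [h8]
      linarith
  · rw [gradient, hfd, LinearIsometryEquiv.symm_apply_eq]
    ext w
    simp [hD, innerBilin_apply]
  · change bilinMatrix (fderiv ℝ (fderiv ℝ φ) x) = _
    rw [hfd, hder2.fderiv]

/-- The supersolution inequality `H(∇φ, D²φ) ≥ l` for all smooth functions that touch `u` from
below with non-vanishing gradient. -/
def TestInequality (H : EuclideanSpace ℝ (Fin n) → Matrix (Fin n) (Fin n) ℝ → ℝ) (l : ℝ)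
    (Ω : Set (EuclideanSpace ℝ (Fin n))) (u : EuclideanSpace ℝ (Fin n) → ℝ) : Prop :=
  ∀ x ∈ Ω, ∀ φ : EuclideanSpace ℝ (Fin n) → ℝ, ContDiffOn ℝ ∞ φ Ω → TouchesFromBelow Ω φ u x →
    gradient φ x ≠ 0 → l ≤ H (gradient φ x) (hessianMatrix φ x)

theorem TestInequality.le_of_quadratic_le
    {H : EuclideanSpace ℝ (Fin n) → Matrix (Fin n) (Fin n) ℝ → ℝ} {l : ℝ}
    {Ω : Set (EuclideanSpace ℝ (Fin n))} {u : EuclideanSpace ℝ (Fin n) → ℝ}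
    (hu : TestInequality H l Ω u) {m : ℝ} (hm : ∀ y ∈ Ω, m ≤ u y)
    {x ξ : EuclideanSpace ℝ (Fin n)} (hx : x ∈ Ω) (hξ : ξ ≠ 0)
    {X : EuclideanSpace ℝ (Fin n) →L[ℝ] EuclideanSpace ℝ (Fin n) →L[ℝ] ℝ}
    (hX : ∀ y z, X y z = X z y)
    (hloc : ∀ᶠ y in 𝓝 x, y ∈ Ω →
      u x + inner ℝ ξ (y - x) + 1 / 2 * X (y - x) (y - x) ≤ u y) :
    l ≤ H ξ (bilinMatrix X) := by
  obtain ⟨φ, hφ, htouch, hgrad, hhess⟩ := exists_test_function hm hX hloc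
  have := hu x hx φ hφ.contDiffOn htouch (hgrad ▸ hξ)
  rwa [hgrad, hhess] at this

theorem fderiv_eq_innerBilin_gradient (φ : EuclideanSpace ℝ (Fin n) → ℝ)
    (x y : EuclideanSpace ℝ (Fin n)) : fderiv ℝ φ x y = inner ℝ (gradient φ x) y := by
  rw [gradient, InnerProductSpace.toDual_symm_apply]

theorem ContDiffAt.eventually_differentiableAt_real {φ : EuclideanSpace ℝ (Fin n) → ℝ}
    {x : EuclideanSpace ℝ (Fin n)} (hφ : ContDiffAt ℝ ∞ φ x) :
    ∀ᶠ y in 𝓝 x, DifferentiableAt ℝ φ y :=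
  ((hφ.of_le (m := 1) (by norm_cast)).eventually (by simp)).mono
    fun _ hy => hy.differentiableAt one_ne_zero

theorem ContDiffAt.hasFDerivAt_fderiv_real {φ : EuclideanSpace ℝ (Fin n) → ℝ}
    {x : EuclideanSpace ℝ (Fin n)} (hφ : ContDiffAt ℝ ∞ φ x) :
    HasFDerivAt (fderiv ℝ φ) (fderiv ℝ (fderiv ℝ φ) x) x :=
  ((hφ.fderiv_right (m := 1) (by norm_cast)).differentiableAt one_ne_zero).hasFDerivAt

theorem ContDiffAt.fderiv_fderiv_symm {φ : EuclideanSpace ℝ (Fin n) → ℝ}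
    {x : EuclideanSpace ℝ (Fin n)} (hφ : ContDiffAt ℝ ∞ φ x) (y z : EuclideanSpace ℝ (Fin n)) :
    fderiv ℝ (fderiv ℝ φ) x y z = fderiv ℝ (fderiv ℝ φ) x z y :=
  second_derivative_symmetric_of_eventually
    (hφ.eventually_differentiableAt_real.mono fun _ hy => hy.hasFDerivAt)
    hφ.hasFDerivAt_fderiv_real y z

theorem eventually_taylor_le_of_contDiffAt {φ : EuclideanSpace ℝ (Fin n) → ℝ}
    {x : EuclideanSpace ℝ (Fin n)} (hφ : ContDiffAt ℝ ∞ φ x) {δ : ℝ} (hδ : 0 < δ) :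
    ∀ᶠ y in 𝓝 x, φ x + inner ℝ (gradient φ x) (y - x)
      + 1 / 2 * fderiv ℝ (fderiv ℝ φ) x (y - x) (y - x) - δ * ‖y - x‖ ^ 2 ≤ φ y := by
  filter_upwards [eventually_abs_sub_taylor_le hφ.eventually_differentiableAt_real
    hφ.hasFDerivAt_fderiv_real hδ] with y hy
  rw [fderiv_eq_innerBilin_gradient] at hy
  linarith [(abs_le.1 hy).1]

end TestFunctions

/-! ### The inequality at test functions with nonzero gradient -/

section MainInequality

variable {n : ℕ}

theorem tendsto_operator_of_tendsto
    {H : EuclideanSpace ℝ (Fin n) → Matrix (Fin n) (Fin n) ℝ → ℝ}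
    (hH : ContinuousOn (fun p : EuclideanSpace ℝ (Fin n) × Matrix (Fin n) (Fin n) ℝ => H p.1 p.2)
      (operatorDomain n))
    {β : Type*} {L : Filter β} {ξs : β → EuclideanSpace ℝ (Fin n)}
    {Xs : β → Matrix (Fin n) (Fin n) ℝ}
    {ξ : EuclideanSpace ℝ (Fin n)} {X : Matrix (Fin n) (Fin n) ℝ} (hξ0 : ξ ≠ 0) (hX0 : X.IsSymm)
    (hξ : Tendsto ξs L (𝓝 ξ)) (hX : Tendsto Xs L (𝓝 X)) (hsymm : ∀ᶠ b in L, (Xs b).IsSymm) :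
    Tendsto (fun b => H (ξs b) (Xs b)) L (𝓝 (H ξ X)) := by
  have h1 : Tendsto (fun b => (ξs b, Xs b)) L (𝓝[operatorDomain n] (ξ, X)) :=
    tendsto_nhdsWithin_iff.2 ⟨hξ.prodMk_nhds hX,
      ((hξ.eventually_ne hξ0).and hsymm).mono fun b hb => hb⟩
  exact Tendsto.comp (hH (ξ, X) ⟨hξ0, hX0⟩) h1

theorem le_operator_of_forall_sub_smul_one
    {H : EuclideanSpace ℝ (Fin n) → Matrix (Fin n) (Fin n) ℝ → ℝ}
    (hH : ContinuousOn (fun p : EuclideanSpace ℝ (Fin n) × Matrix (Fin n) (Fin n) ℝ => H p.1 p.2)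
      (operatorDomain n))
    {ξ : EuclideanSpace ℝ (Fin n)} (hξ : ξ ≠ 0)
    {D : EuclideanSpace ℝ (Fin n) →L[ℝ] EuclideanSpace ℝ (Fin n) →L[ℝ] ℝ}
    (hD : ∀ x y, D x y = D y x) {l : ℝ}
    (h : ∀ δ : ℝ, 0 < δ → l ≤ H ξ (bilinMatrix (D - δ • innerBilin _))) :
    l ≤ H ξ (bilinMatrix D) := by
  have hlim : Tendsto (fun δ : ℝ => bilinMatrix (D - δ • innerBilin _)) (𝓝[>] 0)
      (𝓝 (bilinMatrix D)) := by
    refine tendsto_bilinMatrix fun x y => ?_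
    have : Continuous fun δ : ℝ => D x y - δ * inner ℝ x y := by fun_prop
    simpa [innerBilin_apply] using (this.tendsto 0).mono_left nhdsWithin_le_nhds
  refine ge_of_tendsto (tendsto_operator_of_tendsto hH hξ (isSymm_bilinMatrix hD)
    tendsto_const_nhds hlim (Eventually.of_forall fun δ => isSymm_bilinMatrix fun x y => ?_)) ?_
  · simp [innerBilin_apply, hD x y, real_inner_comm]
  · filter_upwards [self_mem_nhdsWithin] with δ hδ using h δ hδ

/-- The Hessians converge along a subsequence and the gradients `ξ + a i` tend to the common `ξ`;
concavity and ellipticity are applied to the limits. The gradients are nonzero only eventually,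
whence the guard in `h`. -/
theorem sum_mul_le_operator_of_subjets {k : ℕ}
    {H : EuclideanSpace ℝ (Fin n) → Matrix (Fin n) (Fin n) ℝ → ℝ}
    (hH : ContinuousOn (fun p : EuclideanSpace ℝ (Fin n) × Matrix (Fin n) (Fin n) ℝ => H p.1 p.2)
      (operatorDomain n))
    (hell : DegenerateElliptic H)
    (hconc : ∀ ξ : EuclideanSpace ℝ (Fin n), ξ ≠ 0 →
      ConcaveOn ℝ {X : Matrix (Fin n) (Fin n) ℝ | X.IsSymm} (H ξ))
    {t : Fin (k + 1) → ℝ} (ht : ∀ i, 0 < t i) (hsum : ∑ i, t i = 1) {l : Fin (k + 1) → ℝ}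
    {ξ : EuclideanSpace ℝ (Fin n)} (hξ : ξ ≠ 0)
    {B : EuclideanSpace ℝ (Fin n) →L[ℝ] EuclideanSpace ℝ (Fin n) →L[ℝ] ℝ}
    (hB : ∀ x y, B x y = B y x) {K : ℝ}
    (h : ∀ η : ℝ, 0 < η → ∃ (a : Fin (k + 1) → EuclideanSpace ℝ (Fin n))
      (X : Fin (k + 1) → EuclideanSpace ℝ (Fin n) →L[ℝ] EuclideanSpace ℝ (Fin n) →L[ℝ] ℝ),
      (∀ i, ‖a i‖ ≤ η) ∧ (∀ i, ‖X i‖ ≤ K) ∧ (∀ i x y, X i x y = X i y x) ∧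
      (∀ i, ξ + a i ≠ 0 → l i ≤ H (ξ + a i) (bilinMatrix (X i - η • innerBilin _))) ∧
      ∀ ζ, B ζ ζ ≤ ∑ i, t i * X i ζ ζ) :
    ∑ i, t i * l i ≤ H ξ (bilinMatrix B) := by
  have hη : ∀ m : ℕ, 0 < (1 : ℝ) / (m + 1) := fun m => by positivity
  choose a X ha hX hXs hl hsec using fun m : ℕ => h _ (hη m)
  have hηlim : Tendsto (fun m : ℕ => (1 : ℝ) / (m + 1)) atTop (𝓝 0) :=
    tendsto_one_div_add_atTop_nhds_zero_nat
  obtain ⟨Y, s, hs, hYval⟩ := exists_subseq_tendsto_bilin hX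
  have hηs := hηlim.comp hs.tendsto_atTop
  have hYs : ∀ i x y, Y i x y = Y i y x := fun i x y =>
    tendsto_nhds_unique (hYval i x y) (by simpa only [hXs _ i x y] using hYval i y x)
  have hYsec : ∀ ζ, B ζ ζ ≤ ∑ i, t i * Y i ζ ζ := fun ζ =>
    ge_of_tendsto (tendsto_finsetSum _ fun i _ => (hYval i ζ ζ).const_mul (t i))
      (Eventually.of_forall fun m => hsec (s m) ζ)
  have hYl : ∀ i, l i ≤ H ξ (bilinMatrix (Y i)) := by
    intro i
    have halim : Tendsto (fun m => ξ + a (s m) i) atTop (𝓝 ξ) := by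
      have : Tendsto (fun m => a (s m) i) atTop (𝓝 0) :=
        squeeze_zero_norm (fun m => ha (s m) i) hηs
      simpa using this.const_add ξ
    have hXlim : Tendsto (fun m => bilinMatrix
        (X (s m) i - ((1 : ℝ) / ((s m : ℕ) + 1)) • innerBilin _)) atTop
        (𝓝 (bilinMatrix (Y i))) := by
      refine tendsto_bilinMatrix fun x y => ?_
      simpa [innerBilin_apply] using! (hYval i x y).sub (hηs.mul_const (inner ℝ x y))
    refine ge_of_tendsto (tendsto_operator_of_tendsto hH hξ (isSymm_bilinMatrix (hYs i))
      halim hXlim (Eventually.of_forall fun m => isSymm_bilinMatrix fun x y => ?_)) ?_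
    · simp [innerBilin_apply, hXs (s m) i x y, real_inner_comm]
    · filter_upwards [halim.eventually_ne hξ] with m hm using hl (s m) i hm
  calc ∑ i, t i * l i ≤ ∑ i, t i * H ξ (bilinMatrix (Y i)) :=
        Finset.sum_le_sum fun i _ => mul_le_mul_of_nonneg_left (hYl i) (ht i).le
    _ ≤ H ξ (∑ i, t i • bilinMatrix (Y i)) := by
        simpa using (hconc ξ hξ).le_map_sum (t := Finset.univ) (w := t)
          (p := fun i => bilinMatrix (Y i)) (fun i _ => (ht i).le) hsum
          (fun i _ => isSymm_bilinMatrix (hYs i))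
    _ = H ξ (bilinMatrix (∑ i, t i • Y i)) := by
        rw [bilinMatrix_sum]
        simp only [bilinMatrix_smul]
    _ ≤ H ξ (bilinMatrix B) := by
        have hs : ∀ x y, (∑ i, t i • Y i) x y = (∑ i, t i • Y i) y x := by
          intro x y
          simp [hYs _ x y]
        refine hell ξ hξ _ _ (isSymm_bilinMatrix hB) (isSymm_bilinMatrix hs) ?_
        rw [← bilinMatrix_sub]
        refine posSemidef_bilinMatrix (fun x y => ?_) fun ζ => ?_
        · rw [sub_apply, sub_apply, sub_apply, sub_apply, hs x y, hB x y]
        · have := hYsec ζ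
          simp
          linarith

/-- After translation to the `x i` and subtraction of the common linear part, Taylor's formula for
`φ` places a quadratic form in `∑ t_i z_i` below `∑ t_i g_i(z_i)`, and the joint subjets apply. -/
theorem sum_mul_le_operator_of_touching {k : ℕ}
    {H : EuclideanSpace ℝ (Fin n) → Matrix (Fin n) (Fin n) ℝ → ℝ}
    (hH : ContinuousOn (fun p : EuclideanSpace ℝ (Fin n) × Matrix (Fin n) (Fin n) ℝ => H p.1 p.2)
      (operatorDomain n))
    (hell : DegenerateElliptic H)
    (hconc : ∀ ξ : EuclideanSpace ℝ (Fin n), ξ ≠ 0 →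
      ConcaveOn ℝ {X : Matrix (Fin n) (Fin n) ℝ | X.IsSymm} (H ξ))
    {t : Fin (k + 1) → ℝ} (ht : ∀ i, 0 < t i) (hsum : ∑ i, t i = 1) {l : Fin (k + 1) → ℝ}
    {Ω : Fin (k + 1) → Set (EuclideanSpace ℝ (Fin n))} (hΩ : ∀ i, IsOpen (Ω i))
    {v : Fin (k + 1) → EuclideanSpace ℝ (Fin n) → ℝ} (hv : ∀ i, ContinuousOn (v i) (Ω i))
    (hvb : ∀ i, ∃ m : ℝ, ∀ x ∈ Ω i, m ≤ v i x) (hvt : ∀ i, TestInequality H (l i) (Ω i) (v i))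
    {x : Fin (k + 1) → EuclideanSpace ℝ (Fin n)} (hx : ∀ i, x i ∈ Ω i)
    {φ : EuclideanSpace ℝ (Fin n) → ℝ} (hφ : ContDiffAt ℝ ∞ φ (∑ i, t i • x i))
    (hφx : φ (∑ i, t i • x i) = ∑ i, t i * v i (x i))
    (hφle : ∀ y : Fin (k + 1) → EuclideanSpace ℝ (Fin n), (∀ i, y i ∈ Ω i) →
      φ (∑ i, t i • y i) ≤ ∑ i, t i * v i (y i))
    (hgrad : gradient φ (∑ i, t i • x i) ≠ 0) :
    ∑ i, t i * l i ≤ H (gradient φ (∑ i, t i • x i)) (hessianMatrix φ (∑ i, t i • x i)) := by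
  set x₀ := ∑ i, t i • x i with hx₀
  set ξ := gradient φ x₀ with hξ
  set D := fderiv ℝ (fderiv ℝ φ) x₀ with hD
  have hDs : ∀ y z, D y z = D z y := hφ.fderiv_fderiv_symm
  change _ ≤ H ξ (bilinMatrix D)
  refine le_operator_of_forall_sub_smul_one hH hgrad hDs fun δ₀ hδ₀ => ?_
  -- One `δ` is spent on the Taylor remainder of `φ`, four on the joint subjets.
  set δ : ℝ := δ₀ / 5 with hδ
  have hδpos : 0 < δ := by positivity
  set B : EuclideanSpace ℝ (Fin n) →L[ℝ] EuclideanSpace ℝ (Fin n) →L[ℝ] ℝ :=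
    D - δ • innerBilin _ with hB
  have hBs : ∀ y z, B y z = B z y := fun y z => by
    simp [hB, innerBilin_apply, hDs y z, real_inner_comm]
  obtain ⟨r₀, hr₀, htay⟩ := Metric.eventually_nhds_iff_ball.1
    (eventually_taylor_le_of_contDiffAt hφ (half_pos hδpos))
  have hr : ∃ r : ℝ, 0 < r ∧ r < r₀ ∧ ∀ i, Metric.closedBall (x i) r ⊆ Ω i := by
    have h1 : ∀ᶠ r : ℝ in 𝓝[>] 0, ∀ i, Metric.closedBall (x i) r ⊆ Ω i :=
      eventually_all.2 fun i => by
        obtain ⟨ε, hε, hball⟩ := Metric.isOpen_iff.1 (hΩ i) (x i) (hx i)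
        filter_upwards [Ioo_mem_nhdsGT hε] with r hr using
          (Metric.closedBall_subset_ball hr.2).trans hball
    obtain ⟨r, h2, h3⟩ := (h1.and (Ioo_mem_nhdsGT hr₀)).exists
    exact ⟨r, h3.1, h3.2, h2⟩
  obtain ⟨r, hr0, hrr₀, hrΩ⟩ := hr
  set g : Fin (k + 1) → EuclideanSpace ℝ (Fin n) → ℝ := fun i z =>
    v i (x i + z) - v i (x i) - inner ℝ ξ z with hg
  have hmem : ∀ i z, ‖z‖ ≤ r → x i + z ∈ Ω i := fun i z hz =>
    hrΩ i (by simpa [mem_closedBall_iff_norm] using hz)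
  have hgc : ∀ i, ContinuousOn (g i) (Metric.closedBall 0 r) := by
    intro i
    refine ContinuousOn.sub (ContinuousOn.sub ?_ continuousOn_const) (by fun_prop)
    exact (hv i).comp (by fun_prop) fun z hz => hmem i z (mem_closedBall_zero_iff.1 hz)
  have hquad : ∀ z : Fin (k + 1) → EuclideanSpace ℝ (Fin n), (∀ i, ‖z i‖ ≤ r) →
      weightedQuadratic t B 0 z ≤ ∑ i, t i * g i (z i) := by
    intro z hz
    have h1 : ∑ i, t i • (x i + z i) = x₀ + ∑ i, t i • z i := by
      simp only [smul_add, Finset.sum_add_distrib, hx₀]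
    have h2 := hφle (fun i => x i + z i) fun i => hmem i (z i) (hz i)
    rw [h1] at h2
    have h3 : ‖∑ i, t i • z i‖ ≤ r := by
      calc ‖∑ i, t i • z i‖ ≤ ∑ i, ‖t i • z i‖ := norm_sum_le _ _
        _ ≤ ∑ i, t i * r := Finset.sum_le_sum fun i _ => by
            rw [norm_smul, Real.norm_of_nonneg (ht i).le]
            exact mul_le_mul_of_nonneg_left (hz i) (ht i).le
        _ = r := by rw [← Finset.sum_mul, hsum, one_mul]
    have h4 := htay (x₀ + ∑ i, t i • z i)
      (by simpa [mem_ball_iff_norm] using h3.trans_lt hrr₀)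
    rw [add_sub_cancel_left] at h4
    have h5 : ∑ i, t i * g i (z i)
        = ∑ i, t i * v i (x i + z i) - ∑ i, t i * v i (x i) - inner ℝ ξ (∑ i, t i • z i) := by
      rw [inner_sum, ← Finset.sum_sub_distrib, ← Finset.sum_sub_distrib]
      refine Finset.sum_congr rfl fun i _ => ?_
      rw [real_inner_smul_right]
      simp only [hg]
      ring
    rw [h5, weightedQuadratic]
    simp only [hB, sub_apply, smul_apply, innerBilin_apply, smul_eq_mul,
      real_inner_self_eq_norm_sq]
    rw [← hξ, ← hD] at h4
    linarith
  obtain ⟨K, hK⟩ := exists_joint_subjets_of_continuousOn ht hsum hr0 hδpos hgc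
    (fun i => by simp [hg]) hBs hquad
  refine sum_mul_le_operator_of_subjets hH hell hconc ht hsum hgrad (K := K)
    (fun y z => by simp [innerBilin_apply, hDs y z, real_inner_comm]) fun η hη => ?_
  obtain ⟨z, a, X, hz, ha, hX, hXs, hsub, hsec⟩ := hK (min η (r / 2))
    (lt_min hη (by positivity))
  refine ⟨fun i => (InnerProductSpace.toDual ℝ _).symm (a i), X,
    fun i => by
      rw [LinearIsometryEquiv.norm_map]
      exact (ha i).trans (min_le_left _ _), hX, hXs, fun i hi => ?_, fun ζ => ?_⟩
  · obtain ⟨m, hm⟩ := hvb i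
    have hzr : ‖z i‖ ≤ r := ((hz i).trans (min_le_right _ _)).trans (by linarith)
    refine (hvt i).le_of_quadratic_le hm (hmem i (z i) hzr) hi
      (fun y z => by simp [innerBilin_apply, hXs i y z, real_inner_comm]) ?_
    have hlim : Tendsto (fun y => y - x i) (𝓝 (x i + z i)) (𝓝 (z i)) := by
      have : Continuous fun y => y - x i := by fun_prop
      simpa using this.tendsto (x i + z i)
    filter_upwards [hlim.eventually (hsub i (η / 2) (half_pos hη))] with y hy _
    have e1 : y - x i - z i = y - (x i + z i) := by abel
    rw [e1] at hy
    have e2 : inner ℝ ξ (y - x i) = inner ℝ ξ (z i) + inner ℝ ξ (y - (x i + z i)) := by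
      rw [← inner_add_right]; congr 1; abel
    simp only [hg, add_sub_cancel] at hy
    rw [e2] at hy
    rw [inner_add_left, InnerProductSpace.toDual_symm_apply]
    simp only [sub_apply, smul_apply, innerBilin_apply, smul_eq_mul,
      real_inner_self_eq_norm_sq]
    linarith
  · have h1 := hsec ζ
    simp only [hB, sub_apply, smul_apply, innerBilin_apply, smul_eq_mul,
      real_inner_self_eq_norm_sq] at h1 ⊢
    have h2 : δ₀ = 5 * δ := by rw [hδ]; ring
    rw [h2]
    linarith

end MainInequality

/-! ### Semicontinuous envelopes and the operator `G` -/

section Envelopes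

variable {n : ℕ}

theorem le_upperEnvelope_of_frequently
    {H : EuclideanSpace ℝ (Fin n) → Matrix (Fin n) (Fin n) ℝ → ℝ}
    {ξ : EuclideanSpace ℝ (Fin n)} {X : Matrix (Fin n) (Fin n) ℝ} {l : ℝ}
    (h : ∀ c < l, ∃ᶠ p : EuclideanSpace ℝ (Fin n) × Matrix (Fin n) (Fin n) ℝ in
      𝓝[operatorDomain n] (ξ, X), c < H p.1 p.2) :
    (l : EReal) ≤ upperEnvelope H ξ X := by
  by_contra! hlt
  obtain ⟨c, hc1, hc2⟩ := EReal.lt_iff_exists_real_btwn.1 hlt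
  have h1 := eventually_lt_of_limsup_lt hc1
  obtain ⟨p, hp1, hp2⟩ := ((h c (EReal.coe_lt_coe_iff.1 hc2)).and_eventually h1).exists
  exact (EReal.coe_lt_coe_iff.1 hp2).not_gt hp1

theorem upperEnvelope_eq
    {H : EuclideanSpace ℝ (Fin n) → Matrix (Fin n) (Fin n) ℝ → ℝ}
    (hH : ContinuousOn (fun p : EuclideanSpace ℝ (Fin n) × Matrix (Fin n) (Fin n) ℝ => H p.1 p.2)
      (operatorDomain n))
    {ξ : EuclideanSpace ℝ (Fin n)} {X : Matrix (Fin n) (Fin n) ℝ} (hξ : ξ ≠ 0) (hX : X.IsSymm) :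
    upperEnvelope H ξ X = (H ξ X : EReal) := by
  have hmem : (ξ, X) ∈ operatorDomain n := ⟨hξ, hX⟩
  have : (𝓝[operatorDomain n] (ξ, X)).NeBot := mem_closure_iff_nhdsWithin_neBot.1
    (subset_closure hmem)
  exact Tendsto.limsup_eq
    ((continuous_coe_real_ereal.tendsto (H ξ X)).comp (hH (ξ, X) hmem))

/-- Along the trivial filter the lower limit would be `⊤`; thus the normalisation rules out
dimension zero. -/
theorem neBot_of_lowerEnvelope_eq_zero
    {F : EuclideanSpace ℝ (Fin n) → Matrix (Fin n) (Fin n) ℝ → ℝ}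
    (hF : lowerEnvelope F 0 0 = 0) :
    (𝓝[operatorDomain n] ((0 : EuclideanSpace ℝ (Fin n)), (0 : Matrix (Fin n) (Fin n) ℝ))).NeBot := by
  refine ⟨fun hbot => ?_⟩
  rw [lowerEnvelope, hbot] at hF
  simp at hF

theorem frequently_lt_of_nonpos
    {F : EuclideanSpace ℝ (Fin n) → Matrix (Fin n) (Fin n) ℝ → ℝ}
    (hF : lowerEnvelope F 0 0 = 0) (hell : DegenerateElliptic F)
    {X : Matrix (Fin n) (Fin n) ℝ} (hX : X.IsSymm) (hneg : (-X).PosSemidef) :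
    ∀ c < (0 : ℝ), ∃ᶠ p : EuclideanSpace ℝ (Fin n) × Matrix (Fin n) (Fin n) ℝ in
      𝓝[operatorDomain n] (0, X), c < F p.1 p.2 := by
  intro c hc
  have := neBot_of_lowerEnvelope_eq_zero hF
  have hlt : ((c : ℝ) : EReal) < lowerEnvelope F 0 0 := by
    rw [hF]; exact_mod_cast hc
  have h1 := (eventually_lt_of_lt_liminf hlt).and self_mem_nhdsWithin
  have hlim : Tendsto (fun p : EuclideanSpace ℝ (Fin n) × Matrix (Fin n) (Fin n) ℝ =>
      (p.1, p.2 + X)) (𝓝[operatorDomain n] (0, 0)) (𝓝[operatorDomain n] (0, X)) := by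
    refine tendsto_nhdsWithin_iff.2 ⟨?_, ?_⟩
    · have : Continuous fun p : EuclideanSpace ℝ (Fin n) × Matrix (Fin n) (Fin n) ℝ =>
        (p.1, p.2 + X) := by fun_prop
      simpa using (this.tendsto (0, 0)).mono_left nhdsWithin_le_nhds
    · filter_upwards [self_mem_nhdsWithin] with p hp using ⟨hp.1, hp.2.add hX⟩
  refine hlim.frequently (h1.mono fun p hp => ?_).frequently
  refine (EReal.coe_lt_coe_iff.1 hp.1).trans_le (hell p.1 hp.2.1 _ _ (hp.2.2.add hX) hp.2.2 ?_)
  simpa using hneg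

/-- The sign change turns the lower limit of `F` into an upper limit of `G`, so values above `c`
occur only frequently. -/
theorem frequently_lt_modifiedOperator_of_nonpos
    {F : EuclideanSpace ℝ (Fin n) → Matrix (Fin n) (Fin n) ℝ → ℝ}
    (hF : lowerEnvelope F 0 0 = 0) (hell : DegenerateElliptic F)
    {X : Matrix (Fin n) (Fin n) ℝ} (hX : X.IsSymm) (hneg : (-X).PosSemidef) :
    ∀ c < (0 : ℝ), ∃ᶠ p : EuclideanSpace ℝ (Fin n) × Matrix (Fin n) (Fin n) ℝ in
      𝓝[operatorDomain n] (0, X), c < modifiedOperator F p.1 p.2 := by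
  intro c hc
  have hlt : lowerEnvelope F 0 0 < ((-c : ℝ) : EReal) := by
    rw [hF]; exact_mod_cast neg_pos.2 hc
  have h1 := (frequently_lt_of_liminf_lt (by isBoundedDefault) hlt).and_eventually
    self_mem_nhdsWithin
  -- With this substitution `G` becomes `-F(ξ, p.2 - X)`, which is at least `-F(ξ, p.2)` by
  -- ellipticity.
  have hlim : Tendsto (fun p : EuclideanSpace ℝ (Fin n) × Matrix (Fin n) (Fin n) ℝ =>
      (p.1, Matrix.vecMulVec p.1.ofLp p.1.ofLp - p.2 + X)) (𝓝[operatorDomain n] (0, 0))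
      (𝓝[operatorDomain n] (0, X)) := by
    refine tendsto_nhdsWithin_iff.2 ⟨?_, ?_⟩
    · have : Continuous fun p : EuclideanSpace ℝ (Fin n) × Matrix (Fin n) (Fin n) ℝ =>
        (p.1, Matrix.vecMulVec p.1.ofLp p.1.ofLp - p.2 + X) := by
        fun_prop
      simpa using (this.tendsto (0, 0)).mono_left nhdsWithin_le_nhds
    · filter_upwards [self_mem_nhdsWithin] with p hp
      refine ⟨hp.1, (Matrix.IsSymm.sub ?_ hp.2).add hX⟩
      exact Matrix.transpose_vecMulVec _ _
  refine hlim.frequently (h1.mono fun p hp => ?_)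
  have h2 := EReal.coe_lt_coe_iff.1 hp.1
  have h3 : F p.1 (p.2 - X) ≤ F p.1 p.2 :=
    hell p.1 hp.2.1 _ _ hp.2.2 (hp.2.2.sub hX) (by simpa using hneg)
  have h4 : Matrix.vecMulVec p.1.ofLp p.1.ofLp
      - (Matrix.vecMulVec p.1.ofLp p.1.ofLp - p.2 + X) = p.2 - X := by abel
  simp only [modifiedOperator, h4]
  linarith

theorem continuousOn_modifiedOperator
    {F : EuclideanSpace ℝ (Fin n) → Matrix (Fin n) (Fin n) ℝ → ℝ}
    (hF : ContinuousOn (fun p : EuclideanSpace ℝ (Fin n) × Matrix (Fin n) (Fin n) ℝ => F p.1 p.2)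
      (operatorDomain n)) :
    ContinuousOn (fun p : EuclideanSpace ℝ (Fin n) × Matrix (Fin n) (Fin n) ℝ =>
      modifiedOperator F p.1 p.2) (operatorDomain n) := by
  have h1 : Continuous fun p : EuclideanSpace ℝ (Fin n) × Matrix (Fin n) (Fin n) ℝ =>
      (p.1, Matrix.vecMulVec p.1.ofLp p.1.ofLp - p.2) := by fun_prop
  exact (hF.comp h1.continuousOn fun p hp =>
    ⟨hp.1, Matrix.IsSymm.sub (Matrix.transpose_vecMulVec _ _) hp.2⟩).neg

theorem degenerateElliptic_modifiedOperator
    {F : EuclideanSpace ℝ (Fin n) → Matrix (Fin n) (Fin n) ℝ → ℝ} (hF : DegenerateElliptic F) :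
    DegenerateElliptic (modifiedOperator F) := by
  intro ξ hξ X Y hX hY hXY
  have hs : (Matrix.vecMulVec ξ.ofLp ξ.ofLp).IsSymm := Matrix.transpose_vecMulVec _ _
  exact neg_le_neg (hF ξ hξ _ _ (hs.sub hY) (hs.sub hX) (by simpa using hXY))

theorem concaveOn_modifiedOperator
    {F : EuclideanSpace ℝ (Fin n) → Matrix (Fin n) (Fin n) ℝ → ℝ} (hF : ConvexInHessian F)
    {ξ : EuclideanSpace ℝ (Fin n)} (hξ : ξ ≠ 0) :
    ConcaveOn ℝ {X : Matrix (Fin n) (Fin n) ℝ | X.IsSymm} (modifiedOperator F ξ) := by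
  have hs : (Matrix.vecMulVec ξ.ofLp ξ.ofLp).IsSymm := Matrix.transpose_vecMulVec _ _
  refine ⟨(hF ξ hξ).1, fun X hX Y hY a b ha hb hab => ?_⟩
  have h1 := (hF ξ hξ).2 (hs.sub hX) (hs.sub hY) ha hb hab
  have h2 : a • (Matrix.vecMulVec ξ.ofLp ξ.ofLp - X) + b • (Matrix.vecMulVec ξ.ofLp ξ.ofLp - Y)
      = Matrix.vecMulVec ξ.ofLp ξ.ofLp - (a • X + b • Y) := by
    have h3 : a • Matrix.vecMulVec ξ.ofLp ξ.ofLp + b • Matrix.vecMulVec ξ.ofLp ξ.ofLp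
        = Matrix.vecMulVec ξ.ofLp ξ.ofLp := by rw [← add_smul, hab, one_smul]
    rw [smul_sub, smul_sub]
    nth_rewrite 3 [← h3]
    abel
  rw [h2] at h1
  simp only [modifiedOperator, smul_eq_mul] at h1 ⊢
  linarith

end Envelopes

/-! ### Test functions with vanishing gradient -/

section CriticalTestFunctions

/-- `D` has finitely many eigenvalues, so small `δ > 0` avoid them. -/
theorem eventually_nondegenerate {E : Type*} [NormedAddCommGroup E] [InnerProductSpace ℝ E]
    [FiniteDimensional ℝ E] (D : E →L[ℝ] E →L[ℝ] ℝ) :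
    ∀ᶠ δ : ℝ in 𝓝[>] 0, ∀ z, (D - δ • innerBilin E) z = 0 → z = 0 := by
  let A : Module.End ℝ E :=
    { toFun := fun z => (InnerProductSpace.toDual ℝ E).symm (D z)
      map_add' := fun x y => by simp
      map_smul' := fun c x => by simp }
  have hfin : ({μ | A.HasEigenvalue μ} \ {0}).Finite := A.finite_hasEigenvalue.sdiff
  have hmem : ({μ | A.HasEigenvalue μ} \ {0})ᶜ ∈ 𝓝 (0 : ℝ) :=
    hfin.isClosed.compl_mem_nhds (by simp)
  filter_upwards [mem_nhdsWithin_of_mem_nhds hmem, self_mem_nhdsWithin] with δ hδ hδ0 z hz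
  by_contra hz0
  refine hδ ⟨Module.End.hasEigenvalue_of_hasEigenvector
    ⟨Module.End.mem_eigenspace_iff.2 ?_, hz0⟩, (ne_of_gt hδ0 : δ ≠ 0)⟩
  change (InnerProductSpace.toDual ℝ E).symm (D z) = δ • z
  rw [LinearIsometryEquiv.symm_apply_eq]
  have h1 : D z = δ • innerBilin E z := by
    rw [sub_apply, smul_apply] at hz
    exact sub_eq_zero.1 hz
  rw [h1]
  ext w
  simp [innerBilin_apply]

/-- A quadratic modulus of continuity forces the derivative to vanish. -/
theorem eq_of_abs_sub_le_mul_norm_sq {E : Type*} [NormedAddCommGroup E] [NormedSpace ℝ E]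
    {u : E → ℝ} {x : E} {s C : ℝ}
    (h : ∀ a ∈ Metric.ball x s, ∀ b ∈ Metric.ball x s, |u b - u a| ≤ C * ‖b - a‖ ^ 2)
    {a b : E} (ha : a ∈ Metric.ball x s) (hb : b ∈ Metric.ball x s) : u a = u b := by
  have hder : ∀ a ∈ Metric.ball x s, HasFDerivAt u (0 : E →L[ℝ] ℝ) a := by
    intro a ha
    rw [hasFDerivAt_iff_isLittleO]
    have h1 : (fun b => u b - u a - (0 : E →L[ℝ] ℝ) (b - a)) =O[𝓝 a] fun b => ‖b - a‖ ^ 2 := by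
      refine Asymptotics.IsBigO.of_bound C ?_
      filter_upwards [Metric.isOpen_ball.mem_nhds ha] with b hb
      simpa using h a ha b hb
    refine h1.trans_isLittleO ?_
    rw [Asymptotics.isLittleO_iff]
    intro c hc
    filter_upwards [Metric.ball_mem_nhds a hc] with y hy
    rw [mem_ball_iff_norm] at hy
    rw [Real.norm_of_nonneg (by positivity)]
    nlinarith [norm_nonneg (y - a)]
  exact Metric.isOpen_ball.is_const_of_fderiv_eq_zero (𝕜 := ℝ)
    (convex_ball x s).isPreconnected
    (fun a ha => (hder a ha).differentiableAt.differentiableWithinAt)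
    (fun a ha => (hder a ha).fderiv) ha hb

variable {n : ℕ}

theorem fderiv_fderiv_nonpos_of_isLocalMax {φ : EuclideanSpace ℝ (Fin n) → ℝ}
    {x : EuclideanSpace ℝ (Fin n)} (hφ : ContDiffAt ℝ ∞ φ x) (hmax : IsLocalMax φ x)
    (w : EuclideanSpace ℝ (Fin n)) : fderiv ℝ (fderiv ℝ φ) x w w ≤ 0 := by
  have hgrad : gradient φ x = 0 := by
    rw [gradient, hmax.fderiv_eq_zero, map_zero]
  have key : ∀ ε : ℝ, 0 < ε → fderiv ℝ (fderiv ℝ φ) x w w ≤ 0 + ε * (2 * ‖w‖ ^ 2) := by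
    intro ε hε
    have hlim : Tendsto (fun s : ℝ => x + s • w) (𝓝[>] 0) (𝓝 x) := by
      have : Continuous fun s : ℝ => x + s • w := by fun_prop
      simpa using (this.tendsto 0).mono_left nhdsWithin_le_nhds
    obtain ⟨s, ⟨h1, h2⟩, hs⟩ := ((hlim.eventually
      ((eventually_taylor_le_of_contDiffAt hφ hε).and hmax)).and self_mem_nhdsWithin).exists
    have hs : 0 < s := hs
    rw [add_sub_cancel_left, hgrad, inner_zero_left] at h1
    simp only [map_smul, smul_apply, smul_eq_mul, norm_smul, Real.norm_eq_abs, mul_pow,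
      sq_abs] at h1
    have h3 : s ^ 2 * fderiv ℝ (fderiv ℝ φ) x w w ≤ s ^ 2 * (0 + ε * (2 * ‖w‖ ^ 2)) := by
      linarith
    exact le_of_mul_le_mul_left h3 (by positivity)
  by_contra! hpos
  have h1 := key (fderiv ℝ (fderiv ℝ φ) x w w / (2 * (2 * ‖w‖ ^ 2 + 1))) (by positivity)
  rw [zero_add, div_mul_eq_mul_div, le_div_iff₀ (by positivity)] at h1
  nlinarith [sq_nonneg ‖w‖]

theorem posSemidef_neg_hessianMatrix {φ : EuclideanSpace ℝ (Fin n) → ℝ}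
    {x : EuclideanSpace ℝ (Fin n)} (hφ : ContDiffAt ℝ ∞ φ x) (hmax : IsLocalMax φ x) :
    (-hessianMatrix φ x).PosSemidef := by
  have h1 := posSemidef_bilinMatrix (B := (-1 : ℝ) • fderiv ℝ (fderiv ℝ φ) x)
    (fun y z => by simp [hφ.fderiv_fderiv_symm y z])
    (fun w => by simpa using fderiv_fderiv_nonpos_of_isLocalMax hφ hmax w)
  rw [bilinMatrix_smul, neg_one_smul] at h1
  exact h1

theorem isSymm_hessianMatrix {φ : EuclideanSpace ℝ (Fin n) → ℝ}
    {x : EuclideanSpace ℝ (Fin n)} (hφ : ContDiffAt ℝ ∞ φ x) : (hessianMatrix φ x).IsSymm :=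
  isSymm_bilinMatrix hφ.fderiv_fderiv_symm

/-- By contradiction: failure at `φ` persists for a nondegenerate `Y` slightly below `D²φ(x)` and
for small gradients. Sliding the vertex of `½Y` then allows contact with `u` only at the vertex,
which makes `u` locally constant. -/
theorem TestInequality.le_upperEnvelope_zero
    {H : EuclideanSpace ℝ (Fin n) → Matrix (Fin n) (Fin n) ℝ → ℝ}
    (hfreq : ∀ X : Matrix (Fin n) (Fin n) ℝ, X.IsSymm → (-X).PosSemidef → ∀ c < (0 : ℝ),
      ∃ᶠ p : EuclideanSpace ℝ (Fin n) × Matrix (Fin n) (Fin n) ℝ in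
        𝓝[operatorDomain n] (0, X), c < H p.1 p.2)
    {l : ℝ} (hl : l ≤ 0) {Ω : Set (EuclideanSpace ℝ (Fin n))} (hΩ : IsOpen Ω)
    {u : EuclideanSpace ℝ (Fin n) → ℝ} (hlsc : LowerSemicontinuousOn u Ω) {m : ℝ}
    (hm : ∀ y ∈ Ω, m ≤ u y) (hu : TestInequality H l Ω u) {x : EuclideanSpace ℝ (Fin n)}
    (hx : x ∈ Ω) {φ : EuclideanSpace ℝ (Fin n) → ℝ} (hφ : ContDiffOn ℝ ∞ φ Ω)
    (htouch : TouchesFromBelow Ω φ u x) (hgrad : gradient φ x = 0) :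
    (l : EReal) ≤ upperEnvelope H 0 (hessianMatrix φ x) := by
  have hφx : ContDiffAt ℝ ∞ φ x := hφ.contDiffAt (hΩ.mem_nhds hx)
  by_contra! hlt
  obtain ⟨c, hc1, hc2⟩ := EReal.lt_iff_exists_real_btwn.1 hlt
  have hcl : c < l := EReal.coe_lt_coe_iff.1 hc2
  have hev := (eventually_lt_of_limsup_lt hc1).mono fun p hp => EReal.coe_lt_coe_iff.1 hp
  have hev' := eventually_nhdsWithin_iff.1 hev
  rw [nhds_prod_eq, eventually_prod_iff] at hev'
  obtain ⟨pa, hpa, pb, hpb, hp⟩ := hev'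
  set D := fderiv ℝ (fderiv ℝ φ) x with hD
  have hDs : ∀ y z, D y z = D z y := hφx.fderiv_fderiv_symm
  have hlim : Tendsto (fun δ : ℝ => bilinMatrix (D - δ • innerBilin _)) (𝓝[>] 0)
      (𝓝 (hessianMatrix φ x)) := by
    refine tendsto_bilinMatrix fun x y => ?_
    have : Continuous fun δ : ℝ => D x y - δ * inner ℝ x y := by fun_prop
    simpa [innerBilin_apply] using (this.tendsto 0).mono_left nhdsWithin_le_nhds
  obtain ⟨δ, ⟨hδpb, hnondeg⟩, hδ⟩ :=
    (((hlim.eventually hpb).and (eventually_nondegenerate D)).and self_mem_nhdsWithin).exists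
  have hδ : 0 < δ := hδ
  set Y : EuclideanSpace ℝ (Fin n) →L[ℝ] EuclideanSpace ℝ (Fin n) →L[ℝ] ℝ :=
    D - δ • innerBilin _ with hY
  have hYs : ∀ y z, Y y z = Y z y := fun y z => by
    simp [hY, innerBilin_apply, hDs y z, real_inner_comm]
  have hYH : ∀ ξ, pa ξ → ξ ≠ 0 → H ξ (bilinMatrix Y) < l := fun ξ h1 h2 =>
    (hp h1 hδpb ⟨h2, isSymm_bilinMatrix hYs⟩).trans hcl
  obtain ⟨ρ, hρ, hpaρ⟩ := Metric.eventually_nhds_iff_ball.1 hpa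
  obtain ⟨r₀, hr₀, htay⟩ := Metric.eventually_nhds_iff_ball.1
    ((eventually_taylor_le_of_contDiffAt hφx (by positivity : 0 < δ / 4)).and
      (hΩ.eventually_mem hx))
  have hux : φ x = u x := htouch.1
  -- Passing from `D` to `Y` gains `δ/2`, of which the Taylor remainder uses `δ/4`.
  have hquad : ∀ y ∈ Metric.ball x r₀,
      u x + 1 / 2 * Y (y - x) (y - x) + δ / 4 * ‖y - x‖ ^ 2 ≤ u y := by
    intro y hy
    obtain ⟨h1, h2⟩ := htay y hy
    have h3 := htouch.2 y h2
    rw [hgrad, inner_zero_left, ← hD] at h1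
    simp only [hY, sub_apply, smul_apply, innerBilin_apply, smul_eq_mul,
      real_inner_self_eq_norm_sq]
    linarith
  set r := r₀ / 2 with hr
  have hr0 : 0 < r := by positivity
  have hrsub : Metric.closedBall x r ⊆ Metric.ball x r₀ :=
    Metric.closedBall_subset_ball (by linarith)
  set A : ℝ := 4 * ‖Y‖ / δ with hA
  have hA0 : 0 ≤ A := by positivity
  -- For vertex shifts up to `s`, contact occurs inside the ball of radius `r`, with gradient
  -- shorter than `ρ`.
  obtain ⟨s, hs0, hs1, hs2, hs3⟩ : ∃ s : ℝ, 0 < s ∧ s ≤ r ∧ A * s < r ∧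
      ‖Y‖ * ((A + 1) * s) < ρ := by
    have h1 : ∀ᶠ s : ℝ in 𝓝[>] 0, s ≤ r :=
      mem_nhdsWithin_of_mem_nhds (Iic_mem_nhds hr0)
    have h2 : ∀ᶠ s : ℝ in 𝓝[>] 0, A * s < r := by
      have : Continuous fun s : ℝ => A * s := by fun_prop
      exact ((this.tendsto 0).mono_left nhdsWithin_le_nhds).eventually_lt_const (by simpa)
    have h3 : ∀ᶠ s : ℝ in 𝓝[>] 0, ‖Y‖ * ((A + 1) * s) < ρ := by
      have : Continuous fun s : ℝ => ‖Y‖ * ((A + 1) * s) := by fun_prop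
      exact ((this.tendsto 0).mono_left nhdsWithin_le_nhds).eventually_lt_const (by simpa)
    obtain ⟨s, ⟨⟨h1, h2⟩, h3⟩, h4⟩ := (((h1.and h2).and h3).and self_mem_nhdsWithin).exists
    exact ⟨s, h4, h1, h2, h3⟩
  have hcontact : ∀ h : EuclideanSpace ℝ (Fin n), ‖h‖ ≤ s → ∀ y ∈ Metric.closedBall x r,
      u (x + h) ≤ u y - 1 / 2 * Y (y - x - h) (y - x - h) := by
    intro h hh
    have hYcont : Continuous fun y => -(1 / 2 * Y (y - x - h) (y - x - h)) := by fun_prop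
    obtain ⟨y₀, hy₀, hmin⟩ := LowerSemicontinuousOn.exists_isMinOn
      (f := fun y => u y + -(1 / 2 * Y (y - x - h) (y - x - h)))
      ⟨x, Metric.mem_closedBall_self hr0.le⟩ (isCompact_closedBall x r)
      ((hlsc.mono fun y hy => (htay y (hrsub hy)).2).add
        (hYcont.lowerSemicontinuous.lowerSemicontinuousOn _))
    have hmin' : ∀ y ∈ Metric.closedBall x r,
        u y₀ - 1 / 2 * Y (y₀ - x - h) (y₀ - x - h) ≤ u y - 1 / 2 * Y (y - x - h) (y - x - h) :=
      fun y hy => by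
        have := isMinOn_iff.1 hmin y hy
        linarith
    set z := y₀ - x with hz
    have hyz : y₀ = x + z := by rw [hz]; abel
    have hzA : ‖z‖ ≤ A * ‖h‖ := by
      have h1 := hmin' x (Metric.mem_closedBall_self hr0.le)
      have h2 := hquad y₀ (hrsub hy₀)
      rw [← hz] at h2
      have h3 : Y (z - h) (z - h) = Y z z - 2 * Y z h + Y h h := by
        simp only [map_sub, sub_apply]
        rw [hYs h z]; ring
      have h4 : Y (x - x - h) (x - x - h) = Y h h := by simp
      rw [h3, h4] at h1
      have h5 := (abs_le.1 (abs_bilin_le Y z h)).1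
      have h6 : ‖z‖ * (δ / 4 * ‖z‖) ≤ ‖z‖ * (‖Y‖ * ‖h‖) := by linarith
      rcases (norm_nonneg z).eq_or_lt with h7 | h7
      · rw [← h7]; positivity
      · have h8 := le_of_mul_le_mul_left h6 h7
        rw [hA, div_mul_eq_mul_div, le_div_iff₀ hδ]
        linarith
    have hzr : ‖z‖ < r := hzA.trans_lt
      ((mul_le_mul_of_nonneg_left hh hA0).trans_lt hs2)
    have hzh : ‖z - h‖ ≤ (A + 1) * s := by
      have h1 := norm_sub_le z h
      have h2 := mul_le_mul_of_nonneg_left hh hA0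
      linarith
    have hy₀Ω : y₀ ∈ Ω := (htay y₀ (hrsub hy₀)).2
    -- `Y (z - h)` is the gradient of the paraboloid at the contact point; were it nonzero, the test
    -- inequality would contradict `hYH`.
    have hzero : Y (z - h) = 0 := by
      by_contra hne
      set ξ := (InnerProductSpace.toDual ℝ (EuclideanSpace ℝ (Fin n))).symm (Y (z - h)) with hξ
      have hξ0 : ξ ≠ 0 := by
        rw [hξ, Ne, LinearIsometryEquiv.map_eq_zero_iff]
        exact hne
      have hξρ : pa ξ := by
        refine hpaρ ξ (mem_ball_zero_iff.2 ?_)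
        rw [hξ, LinearIsometryEquiv.norm_map]
        exact ((Y.le_opNorm _).trans
          (mul_le_mul_of_nonneg_left hzh (norm_nonneg _))).trans_lt hs3
      refine (hYH ξ hξρ hξ0).not_ge (hu.le_of_quadratic_le hm hy₀Ω hξ0 hYs ?_)
      have hnhds : Metric.closedBall x r ∈ 𝓝 y₀ :=
        mem_of_superset (Metric.isOpen_ball.mem_nhds
          (by rw [mem_ball_iff_norm]; exact hzr)) Metric.ball_subset_closedBall
      filter_upwards [hnhds] with y hy _
      have h1 := hmin' y hy
      have h2 : y - x - h = (z - h) + (y - y₀) := by rw [hz]; abel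
      rw [h2] at h1
      have h3 : Y (z - h + (y - y₀)) (z - h + (y - y₀))
          = Y (z - h) (z - h) + 2 * Y (z - h) (y - y₀) + Y (y - y₀) (y - y₀) := by
        rw [map_add Y, add_apply, map_add, map_add, hYs (y - y₀) (z - h)]
        ring
      rw [h3] at h1
      rw [hξ, InnerProductSpace.toDual_symm_apply]
      linarith
    have hzh0 : z = h := sub_eq_zero.1 (hnondeg _ hzero)
    intro y hy
    have h1 := hmin' y hy
    rw [hyz, hzh0] at h1
    simpa using h1
  -- Every point of the small ball is a contact point at its own vertex; exchanging two such points
  -- bounds `|u b - u a|` quadratically.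
  have hconst : ∀ a ∈ Metric.ball x s, u a = u x := by
    have hle : ∀ a ∈ Metric.ball x s, ∀ b ∈ Metric.ball x s,
        u a - u b ≤ ‖Y‖ / 2 * ‖b - a‖ ^ 2 := by
      intro a ha b hb
      rw [mem_ball_iff_norm] at ha hb
      have h1 := hcontact (a - x) ha.le b (mem_closedBall_iff_norm.2 (hb.le.trans hs1))
      have h2 : b - x - (a - x) = b - a := by abel
      rw [add_sub_cancel, h2] at h1
      have h3 := (abs_le.1 (abs_bilin_self_le Y (b - a))).1
      linarith
    intro a ha
    refine eq_of_abs_sub_le_mul_norm_sq (C := ‖Y‖ / 2) (fun a ha b hb => abs_le.2 ⟨?_, ?_⟩) ha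
      (Metric.mem_ball_self hs0)
    · linarith [hle a ha b hb]
    · have := hle b hb a ha
      rwa [norm_sub_rev] at this
  have hmax : IsLocalMax φ x := by
    filter_upwards [Metric.ball_mem_nhds x hs0] with y hy
    have h1 := htouch.2 y (htay y (hrsub (Metric.ball_subset_closedBall
      (Metric.ball_subset_ball hs1 hy)))).2
    rw [hconst y hy] at h1
    rwa [hux]
  obtain ⟨p, hp1, hp2⟩ := ((hfreq _ (isSymm_hessianMatrix hφx)
    (posSemidef_neg_hessianMatrix hφx hmax) c (hcl.trans_le hl)).and_eventually hev).exists
  exact hp2.not_gt hp1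

end CriticalTestFunctions

/-! ### Attainment and compact sublevel sets of `w` -/

section InfimalConvolution

theorem EReal.coe_sum_real {ι : Type*} (s : Finset ι) (f : ι → ℝ) :
    ((∑ i ∈ s, f i : ℝ) : EReal) = ∑ i ∈ s, (f i : EReal) := by
  classical
  induction s using Finset.induction_on with
  | empty => simp
  | insert a s ha ih => rw [Finset.sum_insert ha, Finset.sum_insert ha, EReal.coe_add, ih]

theorem EReal.sum_ne_bot {ι : Type*} {s : Finset ι} {f : ι → EReal} (h : ∀ i ∈ s, f i ≠ ⊥) :
    ∑ i ∈ s, f i ≠ ⊥ := by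
  classical
  induction s using Finset.induction_on with
  | empty => simp
  | insert a s ha ih =>
    rw [Finset.sum_insert ha, Ne, EReal.add_eq_bot_iff, not_or]
    exact ⟨h a (Finset.mem_insert_self a s),
      ih fun i hi => h i (Finset.mem_insert_of_mem hi)⟩

theorem EReal.sum_eq_top_of_mem {ι : Type*} {s : Finset ι} {f : ι → EReal}
    (h : ∀ i ∈ s, f i ≠ ⊥) {j : ι} (hj : j ∈ s) (hfj : f j = ⊤) : ∑ i ∈ s, f i = ⊤ := by
  classical
  rw [← Finset.add_sum_erase _ _ hj, hfj]
  exact EReal.top_add_of_ne_bot (EReal.sum_ne_bot fun i hi => h i (Finset.mem_of_mem_erase hi))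

theorem extendByTop_of_mem {n : ℕ} {Ω : Set (EuclideanSpace ℝ (Fin n))}
    {v : EuclideanSpace ℝ (Fin n) → ℝ} {x : EuclideanSpace ℝ (Fin n)} (hx : x ∈ Ω) :
    extendByTop Ω v x = v x := if_pos hx

theorem extendByTop_of_notMem {n : ℕ} {Ω : Set (EuclideanSpace ℝ (Fin n))}
    {v : EuclideanSpace ℝ (Fin n) → ℝ} {x : EuclideanSpace ℝ (Fin n)} (hx : x ∉ Ω) :
    extendByTop Ω v x = ⊤ := if_neg hx

theorem isCompact_sublevel_of_blowsUp {n : ℕ} {Ω : Set (EuclideanSpace ℝ (Fin n))}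
    (hΩ : IsOpen Ω) (hb : Bornology.IsBounded Ω) {v : EuclideanSpace ℝ (Fin n) → ℝ}
    (hv : ContinuousOn v Ω) (hblow : BlowsUpAtBoundary Ω v) (C : ℝ) :
    IsCompact {x | x ∈ Ω ∧ v x ≤ C} := by
  refine Metric.isCompact_of_isClosed_isBounded (isClosed_of_closure_subset fun z hz => ?_)
    (hb.subset fun x hx => hx.1)
  have hne : (𝓝[{x | x ∈ Ω ∧ v x ≤ C}] z).NeBot := mem_closure_iff_nhdsWithin_neBot.1 hz
  have hmono : 𝓝[{x | x ∈ Ω ∧ v x ≤ C}] z ≤ 𝓝[Ω] z := nhdsWithin_mono z fun x hx => hx.1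
  have hle : ∀ᶠ x in 𝓝[{x | x ∈ Ω ∧ v x ≤ C}] z, v x ≤ C :=
    eventually_nhdsWithin_of_forall fun x hx => hx.2
  by_cases hzΩ : z ∈ Ω
  · exact ⟨hzΩ, le_of_tendsto ((hv z hzΩ).mono_left hmono) hle⟩
  · exfalso
    have hzf : z ∈ frontier Ω := by
      rw [hΩ.frontier_eq]
      exact ⟨closure_mono (fun x hx => hx.1) hz, hzΩ⟩
    obtain ⟨x, h1, h2⟩ := ((((hblow z hzf).mono_left hmono).eventually_gt_atTop C).and hle).exists
    exact h2.not_gt h1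

variable {n k : ℕ} {t : Fin (k + 1) → ℝ} {Ω : Fin (k + 1) → Set (EuclideanSpace ℝ (Fin n))}
  {v : Fin (k + 1) → EuclideanSpace ℝ (Fin n) → ℝ}

theorem continuousOn_sum_mul (hv : ∀ i, ContinuousOn (v i) (Ω i)) :
    ContinuousOn (fun y : Fin (k + 1) → EuclideanSpace ℝ (Fin n) => ∑ i, t i * v i (y i))
      {y | ∀ i, y i ∈ Ω i} :=
  continuousOn_finsetSum _ fun i _ => continuousOn_const.mul
    ((hv i).comp (continuous_apply i).continuousOn fun _ hy => hy i)

theorem isCompact_sublevel_sum (ht : ∀ i, 0 < t i) (hΩ : ∀ i, IsOpen (Ω i))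
    (hb : ∀ i, Bornology.IsBounded (Ω i)) (hv : ∀ i, ContinuousOn (v i) (Ω i))
    (hvb : ∀ i, ∃ m : ℝ, ∀ x ∈ Ω i, m ≤ v i x)
    (hblow : ∀ i, BlowsUpAtBoundary (Ω i) (v i)) (C : ℝ) :
    IsCompact {y : Fin (k + 1) → EuclideanSpace ℝ (Fin n) |
      (∀ i, y i ∈ Ω i) ∧ ∑ i, t i * v i (y i) ≤ C} := by
  choose m hm using hvb
  -- Lower bounds for the other terms turn a bound on the sum into an upper bound for `v i`.
  set R : Fin (k + 1) → ℝ := fun i =>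
    (t i)⁻¹ * (C - ∑ j ∈ Finset.univ.erase i, t j * m j) with hR
  set P : Set (Fin (k + 1) → EuclideanSpace ℝ (Fin n)) :=
    Set.univ.pi fun i => {x | x ∈ Ω i ∧ v i x ≤ R i} with hP
  have hPc : IsCompact P := isCompact_univ_pi fun i =>
    isCompact_sublevel_of_blowsUp (hΩ i) (hb i) (hv i) (hblow i) (R i)
  have hPΩ : P ⊆ {y | ∀ i, y i ∈ Ω i} := fun y hy i => (hy i trivial).1
  have hcl : IsClosed (P ∩ (fun y => ∑ i, t i * v i (y i)) ⁻¹' Set.Iic C) :=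
    ((continuousOn_sum_mul hv).mono hPΩ).preimage_isClosed_of_isClosed hPc.isClosed isClosed_Iic
  convert hPc.of_isClosed_subset hcl Set.inter_subset_left using 1
  ext y
  refine ⟨fun hy => ⟨fun i _ => ⟨hy.1 i, ?_⟩, hy.2⟩, fun hy => ⟨hPΩ hy.1, hy.2⟩⟩
  have h1 := hy.2
  rw [← Finset.add_sum_erase _ _ (Finset.mem_univ i)] at h1
  have h2 : ∑ j ∈ Finset.univ.erase i, t j * m j ≤ ∑ j ∈ Finset.univ.erase i, t j * v j (y j) :=
    Finset.sum_le_sum fun j _ => mul_le_mul_of_nonneg_left (hm j _ (hy.1 j)) (ht j).le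
  simp only [hR]
  rw [← div_eq_inv_mul, le_div_iff₀ (ht i)]
  linarith

/-- Minimise over the compact set of decompositions no worse than a given one. -/
theorem exists_infimalConvolution_eq (ht : ∀ i, 0 < t i) (hΩ : ∀ i, IsOpen (Ω i))
    (hb : ∀ i, Bornology.IsBounded (Ω i)) (hv : ∀ i, ContinuousOn (v i) (Ω i))
    (hvb : ∀ i, ∃ m : ℝ, ∀ x ∈ Ω i, m ≤ v i x)
    (hblow : ∀ i, BlowsUpAtBoundary (Ω i) (v i)) {x : EuclideanSpace ℝ (Fin n)}
    (hx : x ∈ minkowskiCombination t Ω) :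
    ∃ y : Fin (k + 1) → EuclideanSpace ℝ (Fin n), (∀ i, y i ∈ Ω i) ∧ ∑ i, t i • y i = x ∧
      infimalConvolution t Ω v x = ((∑ i, t i * v i (y i) : ℝ) : EReal) := by
  obtain ⟨y₀, hy₀, hy₀x⟩ := hx
  set S := {y : Fin (k + 1) → EuclideanSpace ℝ (Fin n) |
      (∀ i, y i ∈ Ω i) ∧ ∑ i, t i * v i (y i) ≤ ∑ i, t i * v i (y₀ i)} with hS
  have hSc : IsCompact S := isCompact_sublevel_sum ht hΩ hb hv hvb hblow _
  have hcl : IsClosed {y : Fin (k + 1) → EuclideanSpace ℝ (Fin n) | ∑ i, t i • y i = x} :=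
    isClosed_eq (by fun_prop) continuous_const
  obtain ⟨y, hy, hmin⟩ := (hSc.inter_right hcl).exists_isMinOn ⟨y₀, ⟨hy₀, le_rfl⟩, hy₀x⟩
    ((continuousOn_sum_mul (t := t) hv).mono fun y hy => hy.1.1)
  have hcoe : ∀ y : Fin (k + 1) → EuclideanSpace ℝ (Fin n), (∀ i, y i ∈ Ω i) →
      ∑ i, (t i : EReal) * extendByTop (Ω i) (v i) (y i)
        = ((∑ i, t i * v i (y i) : ℝ) : EReal) := by
    intro y hy
    rw [EReal.coe_sum_real]
    exact Finset.sum_congr rfl fun i _ => by rw [extendByTop_of_mem (hy i), EReal.coe_mul]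
  refine ⟨y, hy.1.1, hy.2, le_antisymm ?_ (le_iInf₂ fun z hz => ?_)⟩
  · exact (iInf₂_le y hy.2).trans_eq (hcoe y hy.1.1)
  · by_cases hzΩ : ∀ i, z i ∈ Ω i
    · rw [hcoe z hzΩ, EReal.coe_le_coe_iff]
      by_cases hzS : ∑ i, t i * v i (z i) ≤ ∑ i, t i * v i (y₀ i)
      · exact isMinOn_iff.1 hmin z ⟨⟨hzΩ, hzS⟩, hz⟩
      · exact hy.1.2.trans (not_le.1 hzS).le
    · push Not at hzΩ
      obtain ⟨j, hj⟩ := hzΩ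
      -- In `EReal`, `⊤ + ⊥ = ⊥`, so one infinite term decides the sum only because no term is `⊥`.
      rw [EReal.sum_eq_top_of_mem (j := j) (fun i _ => ?_) (Finset.mem_univ j)]
      · exact le_top
      · rw [extendByTop_of_notMem hj, EReal.coe_mul_top_of_pos (ht j)]
      · by_cases hi : z i ∈ Ω i
        · rw [extendByTop_of_mem hi, ← EReal.coe_mul]
          exact EReal.coe_ne_bot _
        · rw [extendByTop_of_notMem hi, EReal.coe_mul_top_of_pos (ht i)]
          exact top_ne_bot

theorem infimalConvolution_toReal_le (ht : ∀ i, 0 < t i) (hΩ : ∀ i, IsOpen (Ω i))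
    (hb : ∀ i, Bornology.IsBounded (Ω i)) (hv : ∀ i, ContinuousOn (v i) (Ω i))
    (hvb : ∀ i, ∃ m : ℝ, ∀ x ∈ Ω i, m ≤ v i x)
    (hblow : ∀ i, BlowsUpAtBoundary (Ω i) (v i))
    {y : Fin (k + 1) → EuclideanSpace ℝ (Fin n)} (hy : ∀ i, y i ∈ Ω i) :
    (infimalConvolution t Ω v (∑ i, t i • y i)).toReal ≤ ∑ i, t i * v i (y i) := by
  obtain ⟨z, -, -, heq⟩ := exists_infimalConvolution_eq ht hΩ hb hv hvb hblow ⟨y, hy, rfl⟩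
  have h1 : infimalConvolution t Ω v (∑ i, t i • y i)
      ≤ ((∑ i, t i * v i (y i) : ℝ) : EReal) := by
    unfold infimalConvolution
    refine le_of_le_of_eq (iInf_le_of_le y (iInf_le _ rfl)) ?_
    rw [EReal.coe_sum_real]
    exact Finset.sum_congr rfl fun i _ => by rw [extendByTop_of_mem (hy i), EReal.coe_mul]
  rw [heq, EReal.coe_le_coe_iff] at h1
  rwa [heq, EReal.toReal_coe]

theorem isCompact_sublevel_infimalConvolution (ht : ∀ i, 0 < t i) (hΩ : ∀ i, IsOpen (Ω i))
    (hb : ∀ i, Bornology.IsBounded (Ω i)) (hv : ∀ i, ContinuousOn (v i) (Ω i))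
    (hvb : ∀ i, ∃ m : ℝ, ∀ x ∈ Ω i, m ≤ v i x)
    (hblow : ∀ i, BlowsUpAtBoundary (Ω i) (v i)) (C : ℝ) :
    IsCompact {x | x ∈ minkowskiCombination t Ω ∧ (infimalConvolution t Ω v x).toReal ≤ C} := by
  have hcont : Continuous fun y : Fin (k + 1) → EuclideanSpace ℝ (Fin n) => ∑ i, t i • y i := by
    fun_prop
  convert (isCompact_sublevel_sum ht hΩ hb hv hvb hblow C).image hcont using 1
  ext x
  constructor
  · rintro ⟨hx, hxC⟩
    obtain ⟨y, hy, hyx, heq⟩ := exists_infimalConvolution_eq ht hΩ hb hv hvb hblow hx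
    rw [heq, EReal.toReal_coe] at hxC
    exact ⟨y, ⟨hy, hxC⟩, hyx⟩
  · rintro ⟨y, ⟨hy, hyC⟩, rfl⟩
    exact ⟨⟨y, hy, rfl⟩, (infimalConvolution_toReal_le ht hΩ hb hv hvb hblow hy).trans hyC⟩

/-- Since the weights sum to `1`, translating every summand by one vector translates the combination
by it. -/
theorem isOpen_minkowskiCombination (hsum : ∑ i, t i = 1) (hΩ : ∀ i, IsOpen (Ω i)) :
    IsOpen (minkowskiCombination t Ω) := by
  refine isOpen_iff_mem_nhds.2 ?_
  rintro _ ⟨y, hy, rfl⟩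
  have hev : ∀ᶠ z in 𝓝 (∑ i, t i • y i), ∀ i, y i + (z - ∑ i, t i • y i) ∈ Ω i := by
    refine eventually_all.2 fun i => ?_
    have : Continuous fun z => y i + (z - ∑ i, t i • y i) := by fun_prop
    refine (this.tendsto _).eventually ((hΩ i).mem_nhds ?_)
    simpa using hy i
  filter_upwards [hev] with z hz
  refine ⟨_, hz, ?_⟩
  simp only [smul_add, Finset.sum_add_distrib, ← Finset.sum_smul, hsum]
  rw [one_smul, add_sub_cancel]

end InfimalConvolution

/-! ### Nonnegativity of the principal eigenvalue -/

section Eigenvalue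

variable {n : ℕ}

theorem principalEigenvalue_nonneg (N : ViscosityNotion)
    {F : EuclideanSpace ℝ (Fin n) → Matrix (Fin n) (Fin n) ℝ → ℝ}
    (hF : lowerEnvelope F 0 0 = 0) (hell : DegenerateElliptic F) (α : ℝ)
    {Ω : Set (EuclideanSpace ℝ (Fin n))} (hΩ : IsOpen Ω) :
    0 ≤ principalEigenvalue N F α Ω := by
  have hmax : ∀ x ∈ Ω, ∀ φ : EuclideanSpace ℝ (Fin n) → ℝ,
      TouchesFromBelow Ω φ (fun _ => 1) x → IsLocalMax φ x := by
    intro x hx φ htouch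
    filter_upwards [hΩ.mem_nhds hx] with y hy
    exact (htouch.2 y hy).trans_eq htouch.1.symm
  have hgrad : ∀ x ∈ Ω, ∀ φ : EuclideanSpace ℝ (Fin n) → ℝ,
      TouchesFromBelow Ω φ (fun _ => 1) x → gradient φ x = 0 := by
    intro x hx φ htouch
    rw [gradient, (hmax x hx φ htouch).fderiv_eq_zero, map_zero]
  have hlsc : LowerSemicontinuousOn (fun _ : EuclideanSpace ℝ (Fin n) => (1 : ℝ)) Ω :=
    continuous_const.lowerSemicontinuous.lowerSemicontinuousOn _
  refine le_sSup ⟨0, ⟨fun _ => 1, fun _ _ => one_pos, ?_⟩, by simp⟩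
  cases N with
  | crandallIshiiLions =>
    refine ⟨hlsc, fun x hx φ hφ htouch => ?_⟩
    have hφx := hφ.contDiffAt (hΩ.mem_nhds hx)
    beta_reduce
    rw [hgrad x hx φ htouch, zero_mul]
    exact le_upperEnvelope_of_frequently (frequently_lt_of_nonpos hF hell
      (isSymm_hessianMatrix hφx) (posSemidef_neg_hessianMatrix hφx (hmax x hx φ htouch)))
  | birindelliDemengel =>
    refine ⟨hlsc, fun x hx => ⟨fun c r _ _ _ => ?_, fun φ _ htouch hne => ?_⟩⟩
    · simp
    · exact absurd (hgrad x hx φ htouch) hne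

end Eigenvalue

/-! ### Equivalence of the two notions and conclusion -/

theorem IsViscositySupersolution.testInequality {n : ℕ} {N : ViscosityNotion}
    {H : EuclideanSpace ℝ (Fin n) → Matrix (Fin n) (Fin n) ℝ → ℝ}
    (hH : ContinuousOn (fun p : EuclideanSpace ℝ (Fin n) × Matrix (Fin n) (Fin n) ℝ => H p.1 p.2)
      (operatorDomain n)) {l : ℝ} {Ω : Set (EuclideanSpace ℝ (Fin n))} (hΩ : IsOpen Ω)
    {u : EuclideanSpace ℝ (Fin n) → ℝ}
    (hu : IsViscositySupersolution N H (fun _ => (l : EReal)) Ω u) : TestInequality H l Ω u := by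
  intro x hx φ hφ htouch hgrad
  rw [← EReal.coe_le_coe_iff]
  cases N with
  | crandallIshiiLions =>
    have h1 := hu.2 x hx φ hφ htouch
    rwa [upperEnvelope_eq hH hgrad
      (isSymm_hessianMatrix (hφ.contDiffAt (hΩ.mem_nhds hx)))] at h1
  | birindelliDemengel => exact (hu.2 x hx).2 φ hφ htouch hgrad

theorem TestInequality.isViscositySupersolution {n : ℕ} (N : ViscosityNotion)
    {H : EuclideanSpace ℝ (Fin n) → Matrix (Fin n) (Fin n) ℝ → ℝ}
    (hH : ContinuousOn (fun p : EuclideanSpace ℝ (Fin n) × Matrix (Fin n) (Fin n) ℝ => H p.1 p.2)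
      (operatorDomain n))
    (hfreq : ∀ X : Matrix (Fin n) (Fin n) ℝ, X.IsSymm → (-X).PosSemidef → ∀ c < (0 : ℝ),
      ∃ᶠ p : EuclideanSpace ℝ (Fin n) × Matrix (Fin n) (Fin n) ℝ in
        𝓝[operatorDomain n] (0, X), c < H p.1 p.2)
    {l : ℝ} (hl : l ≤ 0) {Ω : Set (EuclideanSpace ℝ (Fin n))} (hΩ : IsOpen Ω)
    {u : EuclideanSpace ℝ (Fin n) → ℝ} (hlsc : LowerSemicontinuousOn u Ω) {m : ℝ}
    (hm : ∀ y ∈ Ω, m ≤ u y) (hu : TestInequality H l Ω u) :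
    IsViscositySupersolution N H (fun _ => (l : EReal)) Ω u := by
  cases N with
  | crandallIshiiLions =>
    refine ⟨hlsc, fun x hx φ hφ htouch => ?_⟩
    by_cases hgrad : gradient φ x = 0
    · rw [hgrad]
      exact hu.le_upperEnvelope_zero hfreq hl hΩ hlsc hm hx hφ htouch hgrad
    · rw [upperEnvelope_eq hH hgrad
        (isSymm_hessianMatrix (hφ.contDiffAt (hΩ.mem_nhds hx))), EReal.coe_le_coe_iff]
      exact hu x hx φ hφ htouch hgrad
  | birindelliDemengel =>
    refine ⟨hlsc, fun x hx => ⟨fun _ _ _ _ _ => ?_, fun φ hφ htouch hgrad => ?_⟩⟩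
    · beta_reduce
      exact_mod_cast hl
    · exact EReal.coe_le_coe_iff.2 (hu x hx φ hφ htouch hgrad)

theorem isViscositySupersolution_bot {n : ℕ} (N : ViscosityNotion)
    {H : EuclideanSpace ℝ (Fin n) → Matrix (Fin n) (Fin n) ℝ → ℝ}
    {Ω : Set (EuclideanSpace ℝ (Fin n))} {u : EuclideanSpace ℝ (Fin n) → ℝ}
    (hlsc : LowerSemicontinuousOn u Ω) : IsViscositySupersolution N H (fun _ => ⊥) Ω u := by
  cases N with
  | crandallIshiiLions => exact ⟨hlsc, fun _ _ _ _ _ => bot_le⟩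
  | birindelliDemengel =>
    exact ⟨hlsc, fun _ _ => ⟨fun _ _ _ _ _ => bot_le, fun _ _ _ _ => bot_le⟩⟩

theorem propositionp {n k : ℕ}
    (F : EuclideanSpace ℝ (Fin n) → Matrix (Fin n) (Fin n) ℝ → ℝ)
    (hF_cont : ContinuousOn
      (fun p : EuclideanSpace ℝ (Fin n) × Matrix (Fin n) (Fin n) ℝ => F p.1 p.2)
      (operatorDomain n))
    (hF_zero : lowerEnvelope F 0 0 = 0)
    (hF_ell : DegenerateElliptic F)
    (hF_conv : ConvexInHessian F)
    (α : ℝ) (hα : -1 < α)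
    (Ω : Fin (k + 1) → Set (EuclideanSpace ℝ (Fin n)))
    (hΩ_open : ∀ i, IsOpen (Ω i))
    (hΩ_bdd : ∀ i, Bornology.IsBounded (Ω i))
    (t : Fin (k + 1) → ℝ) (ht_pos : ∀ i, 0 < t i) (ht_sum : ∑ i, t i = 1)
    -- the senses of supersolution in the eigenvalue, in the hypotheses and in the conclusion
    (N₀ N₁ N₂ : ViscosityNotion)
    (v : Fin (k + 1) → EuclideanSpace ℝ (Fin n) → ℝ)
    (hv_cont : ∀ i, ContinuousOn (v i) (Ω i))
    (hv_bdd : ∀ i, ∃ m : ℝ, ∀ x ∈ Ω i, m ≤ v i x)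
    (hv_super : ∀ i, IsViscositySupersolution N₁ (modifiedOperator F)
      (fun _ => -principalEigenvalue N₀ F α (Ω i)) (Ω i) (v i))
    (hv_blow : ∀ i, BlowsUpAtBoundary (Ω i) (v i)) :
    (∀ x ∈ minkowskiCombination t Ω,
      infimalConvolution t Ω v x ≠ ⊥ ∧ infimalConvolution t Ω v x ≠ ⊤) ∧
    IsViscositySupersolution N₂ (modifiedOperator F)
      (fun _ => -∑ i, (t i : EReal) * principalEigenvalue N₀ F α (Ω i))
      (minkowskiCombination t Ω) (fun x => (infimalConvolution t Ω v x).toReal) ∧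
    BlowsUpAtBoundary (minkowskiCombination t Ω)
      (fun x => (infimalConvolution t Ω v x).toReal) := by
  set W : EuclideanSpace ℝ (Fin n) → ℝ := fun x => (infimalConvolution t Ω v x).toReal with hW
  have hex := fun {x : EuclideanSpace ℝ (Fin n)} (hx : x ∈ minkowskiCombination t Ω) =>
    exists_infimalConvolution_eq ht_pos hΩ_open hΩ_bdd hv_cont hv_bdd hv_blow hx
  have hopen : IsOpen (minkowskiCombination t Ω) := isOpen_minkowskiCombination ht_sum hΩ_open
  -- Sublevel sets of `W` are closed in the whole space, which gives lower semicontinuity at points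
  -- of the domain and blow-up at its boundary together.
  have hgt : ∀ (C : ℝ) (z : EuclideanSpace ℝ (Fin n)),
      (z ∈ minkowskiCombination t Ω → C < W z) →
      ∀ᶠ x in 𝓝[minkowskiCombination t Ω] z, C < W x := by
    intro C z hz
    have hclosed := (isCompact_sublevel_infimalConvolution ht_pos hΩ_open hΩ_bdd hv_cont hv_bdd
      hv_blow C).isClosed
    have hmem := hclosed.compl_mem_nhds (x := z) fun h => (hz h.1).not_ge h.2
    filter_upwards [mem_nhdsWithin_of_mem_nhds hmem, self_mem_nhdsWithin] with x hx hxΩ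
    exact not_le.1 fun h => hx ⟨hxΩ, h⟩
  have hlsc : LowerSemicontinuousOn W (minkowskiCombination t Ω) :=
    fun z _ C hC => hgt C z fun _ => hC
  refine ⟨fun x hx => ?_, ?_, fun z hz => ?_⟩
  · obtain ⟨y, -, -, heq⟩ := hex hx
    rw [heq]
    exact ⟨EReal.coe_ne_bot _, EReal.coe_ne_top _⟩
  · have hnonneg : ∀ i, 0 ≤ principalEigenvalue N₀ F α (Ω i) := fun i =>
      principalEigenvalue_nonneg N₀ hF_zero hF_ell α (hΩ_open i)
    have hne_bot : ∀ i, principalEigenvalue N₀ F α (Ω i) ≠ ⊥ := fun i =>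
      (EReal.bot_lt_zero.trans_le (hnonneg i)).ne'
    -- An infinite eigenvalue makes the right-hand side `⊥`, as the other terms are nonnegative;
    -- nothing remains to be tested.
    by_cases htop : ∃ i, principalEigenvalue N₀ F α (Ω i) = ⊤
    · obtain ⟨j, hj⟩ := htop
      have hsum_top : ∑ i, (t i : EReal) * principalEigenvalue N₀ F α (Ω i) = ⊤ := by
        refine EReal.sum_eq_top_of_mem (j := j) (fun i _ => ?_) (Finset.mem_univ j) ?_
        · have : 0 ≤ (t i : EReal) * principalEigenvalue N₀ F α (Ω i) :=
            mul_nonneg (EReal.coe_nonneg.2 (ht_pos i).le) (hnonneg i)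
          exact (EReal.bot_lt_zero.trans_le this).ne'
        · rw [hj, EReal.coe_mul_top_of_pos (ht_pos j)]
      rw [hsum_top, EReal.neg_top]
      exact isViscositySupersolution_bot N₂ hlsc
    · push Not at htop
      have hreal : ∀ i, ∃ l : ℝ, principalEigenvalue N₀ F α (Ω i) = (l : EReal) := fun i =>
        ⟨_, (EReal.coe_toReal (htop i) (hne_bot i)).symm⟩
      choose l hl using hreal
      have hl0 : ∀ i, 0 ≤ l i := fun i => by
        have := hnonneg i
        rw [hl] at this
        exact_mod_cast this
      have hrhs : -∑ i, (t i : EReal) * principalEigenvalue N₀ F α (Ω i)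
          = ((∑ i, t i * -l i : ℝ) : EReal) := by
        simp only [hl, mul_neg, Finset.sum_neg_distrib]
        rw [EReal.coe_neg, EReal.coe_sum_real]
        simp only [EReal.coe_mul]
      rw [hrhs]
      have hG := continuousOn_modifiedOperator hF_cont
      have htest : ∀ i, TestInequality (modifiedOperator F) (-l i) (Ω i) (v i) := fun i => by
        have := hv_super i
        rw [hl, ← EReal.coe_neg] at this
        exact this.testInequality hG (hΩ_open i)
      choose m hm using hv_bdd
      refine TestInequality.isViscositySupersolution N₂ hG
        (fun X hX hneg => frequently_lt_modifiedOperator_of_nonpos hF_zero hF_ell hX hneg)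
        (Finset.sum_nonpos fun i _ => mul_nonpos_of_nonneg_of_nonpos (ht_pos i).le
          (neg_nonpos.2 (hl0 i))) hopen hlsc (m := ∑ i, t i * m i) (fun x hx => ?_) ?_
      · obtain ⟨y, hy, -, heq⟩ := hex hx
        simp only [hW, heq, EReal.toReal_coe]
        exact Finset.sum_le_sum fun i _ =>
          mul_le_mul_of_nonneg_left (hm i _ (hy i)) (ht_pos i).le
      · intro x hx φ hφ htouch hgrad
        obtain ⟨y, hy, rfl, heq⟩ := hex hx
        refine sum_mul_le_operator_of_touching hG (degenerateElliptic_modifiedOperator hF_ell)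
          (fun ξ hξ => concaveOn_modifiedOperator hF_conv hξ) ht_pos ht_sum hΩ_open hv_cont
          (fun i => ⟨m i, hm i⟩) htest hy (hφ.contDiffAt (hopen.mem_nhds hx)) ?_
          (fun z hz => ?_) hgrad
        · rw [htouch.1]
          simp only [hW, heq, EReal.toReal_coe]
        · exact (htouch.2 _ ⟨z, hz, rfl⟩).trans (infimalConvolution_toReal_le ht_pos hΩ_open
            hΩ_bdd hv_cont (fun i => ⟨m i, hm i⟩) hv_blow hz)
  · refine tendsto_atTop.2 fun C => (hgt C z fun hzΩ => ?_).mono fun x hx => hx.le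
    rw [hopen.frontier_eq] at hz
    exact absurd hzΩ hz.2
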